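/- Let $\mathbb T^2=\mathbb R^2/\mathbb Z^2$, with coordinates $x=(x^1,x^2)$, and let $y=(y^1,y^2)$ be the coordinates of $\mathbb R^2$. Let $\mathcal O_C(\mathbb R^2)$ be the space of smooth functions $f:\mathbb R^2\to\mathbb C$ for which there is $k\in\mathbb Z$ such that $(1+|y|^2)^k\,\partial^\alpha f(y)$ is bounded for every multi-index $\alpha$. It carries its locally convex topology: the inductive limit, over $k$, of the Fréchet spaces of smooth functions $f$ with $\sup_y(1+|y|^2)^k|\partial^\alpha f(y)|<\infty$ for all $\alpha$. Let $\mathcal W=\mathbb T^2\times\mathcal O_C(\mathbb R^2)$ be the trivial bundle over $\mathbb T^2$ with fibre $\mathcal O_C(\mathbb R^2)$, let $\Omega^p(\mathbb T^2,\mathcal W)$ be the space of smooth $\mathcal W$-valued differential forms of degree $p$ on $\mathbb T^2$ (the coefficients of the form in the frame $dx^1,dx^2$ are smooth maps $\mathbb T^2\to\mathcal O_C(\mathbb R^2)$), and let $$Q=\sum_{i=1}^2 dx^i\wedge\Big(\frac{\partial}{\partial x^i}-\frac{\partial}{\partial y^i}\Big):\ \Omega^p(\mathbb T^2,\mathcal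 W)\to\Omega^{p+1}(\mathbb T^2,\mathcal W).$$ Then $Q^2=0$, and the complex $(\Omega^\bullet(\mathbb T^2,\mathcal W),Q)$ is acyclic: its cohomology vanishes in every degree $p\ge1$. Its $0$-th cohomology is $C^\infty(\mathbb T^2)=C^\infty(\mathbb T^2,\mathbb C)$: an element $f\in\Omega^0(\mathbb T^2,\mathcal W)$ satisfies $Qf=0$ if and only if there is $g\in C^\infty(\mathbb T^2)$ with $f(x,y)=g(x+y)$ for all $x\in\mathbb T^2$, $y\in\mathbb R^2$, and restriction to $y=0$, $\sigma(f)(x)=f(x,0)$, is a linear isomorphism $H^0(\Omega(\mathbb T^2,\mathcal W),Q)\to C^\infty(\mathbb T^2)$. -/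

import Mathlib

open Filter
open scoped ContDiff Topology

noncomputable section

/-! ### The torus and smooth maps from it into a topological vector space -/

/-- The torus `𝕋² = ℝ²/ℤ²`. -/
abbrev Torus2 : Type := Fin 2 → UnitAddCircle

/-- The Euclidean plane `ℝ²`. It serves as the fibre coordinate space, as the universal cover of
the torus, and as the tangent space of the torus at each of its points. -/
abbrev Plane : Type := EuclideanSpace ℝ (Fin 2)

/-- The standard basis vectors of `ℝ²`. -/
def stdVec (i : Fin 2) : Plane := EuclideanSpace.single i 1

/-- The quotient map `ℝ² → 𝕋²`. -/
def torusMk (v : Plane) : Torus2 := fun i => (v i : UnitAddCircle)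

section SmoothTorus

variable {E : Type} [AddCommGroup E] [Module ℂ E] [TopologicalSpace E]

/-- `F' = ∂F/∂xⁱ` on the torus, as a limit of difference quotients in the topology of `E`. -/
def HasTorusPartial (i : Fin 2) (F F' : Torus2 → E) : Prop :=
  ∀ x, Tendsto (fun t : ℝ => (t : ℂ)⁻¹ • (F (x + torusMk (t • stdVec i)) - F x))
    (𝓝[≠] 0) (𝓝 (F' x))

/-- `F : 𝕋² → E` is smooth: all partial derivatives `D α = ∂^α F`, `α` a multi-index, exist
and are continuous, as maps into the topological vector space `E`. -/
def IsSmoothOnTorus (F : Torus2 → E) : Prop :=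
  ∃ D : (Fin 2 → ℕ) → Torus2 → E, D 0 = F ∧
    ∀ a, Continuous (D a) ∧ ∀ i, HasTorusPartial i (D a) (D (a + Pi.single i 1))

theorem HasTorusPartial.unique [T2Space E] {i : Fin 2} {F F₁ F₂ : Torus2 → E}
    (h₁ : HasTorusPartial i F F₁) (h₂ : HasTorusPartial i F F₂) : F₁ = F₂ :=
  funext fun x => tendsto_nhds_unique (h₁ x) (h₂ x)

theorem HasTorusPartial.add [ContinuousAdd E] {i : Fin 2} {F F' G G' : Torus2 → E}
    (h : HasTorusPartial i F F') (k : HasTorusPartial i G G') :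
    HasTorusPartial i (F + G) (F' + G') := by
  intro x
  refine ((h x).add (k x)).congr fun t => ?_
  rw [← smul_add]
  congr 1
  simp only [Pi.add_apply]
  abel

theorem HasTorusPartial.const_smul [ContinuousConstSMul ℂ E] {i : Fin 2} {F F' : Torus2 → E}
    (c : ℂ) (h : HasTorusPartial i F F') : HasTorusPartial i (c • F) (c • F') := by
  intro x
  refine ((h x).const_smul c).congr fun t => ?_
  rw [smul_comm, smul_sub]
  rfl

variable (E) in
/-- The space `C^∞(𝕋², E)` of smooth maps from the torus to `E`. -/
def smoothTorus [IsTopologicalAddGroup E] [ContinuousConstSMul ℂ E] :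
    Submodule ℂ (Torus2 → E) where
  carrier := {F | IsSmoothOnTorus F}
  zero_mem' := ⟨0, rfl, fun _ => ⟨continuous_const, fun _ _ => by
    simpa using tendsto_const_nhds⟩⟩
  add_mem' := by
    rintro F G ⟨D, rfl, hD⟩ ⟨D', rfl, hD'⟩
    exact ⟨D + D', rfl, fun a => ⟨(hD a).1.add (hD' a).1,
      fun i => ((hD a).2 i).add ((hD' a).2 i)⟩⟩
  smul_mem' := by
    rintro c F ⟨D, rfl, hD⟩
    exact ⟨c • D, rfl, fun a => ⟨(hD a).1.const_smul c, fun i => ((hD a).2 i).const_smul c⟩⟩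

variable [IsTopologicalAddGroup E] [ContinuousConstSMul ℂ E]

theorem exists_torusPartial (i : Fin 2) (F : smoothTorus E) :
    ∃ G : smoothTorus E, HasTorusPartial i (F : Torus2 → E) (G : Torus2 → E) := by
  obtain ⟨F, D, rfl, hD⟩ := F
  refine ⟨⟨D (Pi.single i 1), fun a => D (a + Pi.single i 1), by simp, fun a =>
    ⟨(hD _).1, fun j => ?_⟩⟩, ?_⟩
  · have := (hD (a + Pi.single i 1)).2 j
    rwa [add_right_comm] at this
  · simpa using (hD 0).2 i

/-- The operator `∂/∂xⁱ` on `C^∞(𝕋², E)`. -/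
def torusPartial [T2Space E] (i : Fin 2) : smoothTorus E →ₗ[ℂ] smoothTorus E where
  toFun F := (exists_torusPartial i F).choose
  map_add' F G := Subtype.ext <|
    (exists_torusPartial i (F + G)).choose_spec.unique
      ((exists_torusPartial i F).choose_spec.add (exists_torusPartial i G).choose_spec)
  map_smul' c F := Subtype.ext <|
    (exists_torusPartial i (c • F)).choose_spec.unique
      ((exists_torusPartial i F).choose_spec.const_smul c)

theorem torusPartial_spec [T2Space E] (i : Fin 2) (F : smoothTorus E) :
    HasTorusPartial i (F : Torus2 → E) (torusPartial i F : Torus2 → E) :=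
  (exists_torusPartial i F).choose_spec

/-- Composition with a continuous linear operator of the target, on `C^∞(𝕋², E)`. -/
def smoothTorusMap (L : E →L[ℂ] E) : smoothTorus E →ₗ[ℂ] smoothTorus E where
  toFun F := ⟨fun x => L (F.1 x), by
    obtain ⟨F, D, rfl, hD⟩ := F
    refine ⟨fun a x => L (D a x), rfl, fun a => ⟨L.continuous.comp (hD a).1, fun i x => ?_⟩⟩
    refine ((L.continuous.tendsto _).comp ((hD a).2 i x)).congr fun t => ?_
    simp⟩
  map_add' F G := Subtype.ext <| funext fun x => by simp
  map_smul' c F := Subtype.ext <| funext fun x => by simp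

end SmoothTorus

/-! ### The space `𝒪_C(ℝ²)` with its inductive limit topology -/

/-- `(1+|y|²)^k |∂^α f(y)| ≤ B` for all `y`, for all derivatives of order `j`, which are collected
in the `j`-th iterated Fréchet derivative. -/
def WeightedBound (k : ℤ) (j : ℕ) (f : Plane → ℂ) (B : ℝ) : Prop :=
  ∀ y, (1 + ‖y‖ ^ 2) ^ k * ‖iteratedFDeriv ℝ j f y‖ ≤ B

/-- The smooth functions `f` on `ℝ²` for which `(1+|y|²)^k ∂^α f(y)` is bounded for every
multi-index `α`. With the norms of all these functions this is the Fréchet space of which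
`𝒪_C(ℝ²)` is the union. -/
def InStep (k : ℤ) (f : Plane → ℂ) : Prop :=
  ContDiff ℝ ∞ f ∧ ∀ j, ∃ B, WeightedBound k j f B

theorem WeightedBound.mono {k l : ℤ} (hkl : k ≤ l) {j : ℕ} {f : Plane → ℂ} {B : ℝ}
    (h : WeightedBound l j f B) : WeightedBound k j f B := fun y =>
  (mul_le_mul_of_nonneg_right
    (zpow_le_zpow_right₀ (by nlinarith [sq_nonneg ‖y‖]) hkl) (norm_nonneg _)).trans (h y)

theorem InStep.mono {k l : ℤ} (hkl : k ≤ l) {f : Plane → ℂ} (h : InStep l f) : InStep k f :=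
  ⟨h.1, fun j => (h.2 j).imp fun _ hB => hB.mono hkl⟩

theorem InStep.add {k : ℤ} {f g : Plane → ℂ} (hf : InStep k f) (hg : InStep k g) :
    InStep k (f + g) := by
  refine ⟨hf.1.add hg.1, fun j => ?_⟩
  obtain ⟨B, hB⟩ := hf.2 j
  obtain ⟨C, hC⟩ := hg.2 j
  refine ⟨B + C, fun y => ?_⟩
  rw [iteratedFDeriv_add_apply (hf.1.of_le (mod_cast le_top)).contDiffAt
    (hg.1.of_le (mod_cast le_top)).contDiffAt]
  have h1 : (0 : ℝ) ≤ (1 + ‖y‖ ^ 2) ^ k := by positivity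
  calc _ ≤ (1 + ‖y‖ ^ 2) ^ k * (‖iteratedFDeriv ℝ j f y‖ + ‖iteratedFDeriv ℝ j g y‖) :=
        mul_le_mul_of_nonneg_left (norm_add_le _ _) h1
    _ ≤ _ := by rw [mul_add]; exact add_le_add (hB y) (hC y)

theorem InStep.const_smul {k : ℤ} {f : Plane → ℂ} (c : ℂ) (hf : InStep k f) :
    InStep k (c • f) := by
  refine ⟨hf.1.const_smul c, fun j => ?_⟩
  obtain ⟨B, hB⟩ := hf.2 j
  refine ⟨‖c‖ * B, fun y => ?_⟩
  rw [iteratedFDeriv_const_smul_apply (hf.1.of_le (mod_cast le_top)).contDiffAt, norm_smul,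
    mul_left_comm]
  exact mul_le_mul_of_nonneg_left (hB y) (norm_nonneg _)

/-- The functions in `𝒪_C(ℝ²)`: the smooth functions `f` such that for some integer `k`, the
function `(1+|y|²)^k ∂^α f(y)` is bounded for every multi-index `α`. -/
def ocSubmodule : Submodule ℂ (Plane → ℂ) where
  carrier := {f | ∃ k, InStep k f}
  zero_mem' := ⟨0, contDiff_const, fun j => ⟨0, fun y => by
    simp [show (0 : Plane → ℂ) = fun _ => 0 from rfl]⟩⟩
  add_mem' := by
    rintro f g ⟨k, hf⟩ ⟨l, hg⟩
    exact ⟨min k l, (hf.mono (min_le_left _ _)).add (hg.mono (min_le_right _ _))⟩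
  smul_mem' := by
    rintro c f ⟨k, hf⟩
    exact ⟨k, hf.const_smul c⟩

/-- The space `𝒪_C(ℝ²)`. It is a type of its own, so that it does not carry the topology of
pointwise convergence. -/
def OC : Type := ocSubmodule

namespace OC

instance : AddCommGroup OC := inferInstanceAs (AddCommGroup ocSubmodule)

instance : Module ℂ OC := inferInstanceAs (Module ℂ ocSubmodule)

/-- The underlying function of an element of `𝒪_C(ℝ²)`. -/
def val (f : OC) : Plane → ℂ := Subtype.val f

instance : CoeFun OC fun _ => Plane → ℂ := ⟨val⟩

/-- The element of `𝒪_C(ℝ²)` given by a function. -/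
def mk (f : Plane → ℂ) (hf : ∃ k, InStep k f) : OC := ⟨f, hf⟩

theorem val_mk (f : Plane → ℂ) (hf : ∃ k, InStep k f) : (mk f hf).val = f := rfl

theorem val_add (f g : OC) : (f + g).val = f.val + g.val := rfl

theorem val_smul (c : ℂ) (f : OC) : (c • f).val = c • f.val := rfl

theorem exists_inStep (f : OC) : ∃ k, InStep k f := f.2

theorem contDiff (f : OC) : ContDiff ℝ ∞ f.val := f.2.choose_spec.1

theorem ext {f g : OC} (h : ∀ y, f y = g y) : f = g := Subtype.ext (funext h)

/-- A seminorm on `𝒪_C(ℝ²)` whose restriction to each step (the Fréchet space of the functions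
`f` with `(1+|y|²)^k ∂^α f(y)` bounded for all `α`) is continuous, that is, bounded by
a multiple of finitely many of the norms `sup_y (1+|y|²)^k |D^j f(y)|` of the step. -/
def IsStepwiseContinuous (p : Seminorm ℂ OC) : Prop :=
  ∀ k : ℤ, ∃ (m : ℕ) (C : ℝ), ∀ f : OC, InStep k f →
    ∀ B : ℝ, (∀ j ≤ m, WeightedBound k j f B) → p f ≤ C * B

/-- All seminorms on `𝒪_C(ℝ²)` that are continuous on each step. -/
def seminorms : SeminormFamily ℂ OC {p : Seminorm ℂ OC // IsStepwiseContinuous p} :=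
  fun p => p.1

instance : Nonempty {p : Seminorm ℂ OC // IsStepwiseContinuous p} :=
  ⟨0, fun _ => ⟨0, 0, fun _ _ _ _ => by simp⟩⟩

/-- The locally convex inductive limit topology of `𝒪_C(ℝ²)`: the finest locally convex topology
for which the inclusions of all the steps are continuous. -/
instance : TopologicalSpace OC := seminorms.moduleFilterBasis.topology

theorem withSeminorms : WithSeminorms seminorms := ⟨rfl⟩

instance : IsTopologicalAddGroup OC := withSeminorms.topologicalAddGroup

instance : ContinuousSMul ℂ OC := withSeminorms.continuousSMul

/-- Evaluation at a point, as a seminorm. -/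
def evalSeminorm (y : Plane) : Seminorm ℂ OC where
  toFun f := ‖f y‖
  map_zero' := show ‖(0 : ℂ)‖ = 0 from norm_zero
  add_le' f g := norm_add_le (f y) (g y)
  neg' f := norm_neg (f y)
  smul' c f := norm_smul c (f y)

theorem isStepwiseContinuous_evalSeminorm (y : Plane) :
    IsStepwiseContinuous (evalSeminorm y) := by
  intro k
  refine ⟨0, ((1 + ‖y‖ ^ 2) ^ k)⁻¹, fun f _ B hB => ?_⟩
  have h := hB 0 le_rfl y
  rw [norm_iteratedFDeriv_zero] at h
  have h1 : (0 : ℝ) < (1 + ‖y‖ ^ 2) ^ k := by positivity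
  rw [inv_mul_eq_div, le_div_iff₀ h1, mul_comm]
  exact h

instance : T2Space OC := by
  have : T1Space OC := withSeminorms.T1_of_separating fun f hf => by
    by_contra! h
    refine hf (ext fun y => ?_)
    have := h ⟨evalSeminorm y, isStepwiseContinuous_evalSeminorm y⟩
    exact norm_eq_zero.1 this
  infer_instance

theorem weightedBound_partial {k : ℤ} {j : ℕ} {f : Plane → ℂ} (hf : ContDiff ℝ ∞ f) {B : ℝ}
    (i : Fin 2) (h : WeightedBound k (j + 1) f B) :
    WeightedBound k j (fun y => fderiv ℝ f y (stdVec i)) B := by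
  intro y
  have h1 : (0 : ℝ) ≤ (1 + ‖y‖ ^ 2) ^ k := by positivity
  refine (mul_le_mul_of_nonneg_left ?_ h1).trans (h y)
  rw [← norm_iteratedFDeriv_fderiv]
  have hd : ContDiff ℝ ∞ (fderiv ℝ f) := hf.fderiv_right (by simp)
  have h2 := ((ContinuousLinearMap.apply ℝ ℂ (stdVec i)).norm_iteratedFDeriv_comp_left
    (x := y) (n := j) (N := ∞) hd.contDiffAt (mod_cast le_top))
  refine h2.trans ?_
  have h3 : ‖ContinuousLinearMap.apply ℝ ℂ (stdVec i)‖ ≤ 1 := by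
    refine ContinuousLinearMap.opNorm_le_bound _ zero_le_one fun L => ?_
    have := L.le_opNorm (stdVec i)
    simpa [stdVec] using this
  exact mul_le_of_le_one_left (norm_nonneg _) h3

theorem inStep_partial {k : ℤ} {f : Plane → ℂ} (hf : InStep k f) (i : Fin 2) :
    InStep k (fun y => fderiv ℝ f y (stdVec i)) :=
  ⟨(hf.1.fderiv_right (m := ∞) (by simp)).clm_apply contDiff_const,
    fun j => (hf.2 (j + 1)).imp fun _ hB => weightedBound_partial hf.1 i hB⟩

/-- The operator `∂/∂yⁱ` on `𝒪_C(ℝ²)`, as a linear map. -/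
def partialLM (i : Fin 2) : OC →ₗ[ℂ] OC where
  toFun f := mk (fun y => fderiv ℝ f.val y (stdVec i))
    (f.exists_inStep.imp fun _ hk => inStep_partial hk i)
  map_add' f g := ext fun y => by
    have hf := (f.contDiff.differentiable (by simp)).differentiableAt (x := y)
    have hg := (g.contDiff.differentiable (by simp)).differentiableAt (x := y)
    simp only [val_mk, val_add, fderiv_add hf hg, Pi.add_apply]
    rfl
  map_smul' c f := ext fun y => by
    have hf := (f.contDiff.differentiable (by simp)).differentiableAt (x := y)
    simp only [val_mk, val_smul, fderiv_const_smul hf, Pi.smul_apply, RingHom.id_apply]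
    rfl

/-- The continuous linear operator `∂/∂yⁱ` on `𝒪_C(ℝ²)`. -/
def partialY (i : Fin 2) : OC →L[ℂ] OC where
  toLinearMap := partialLM i
  cont := by
    refine WithSeminorms.continuous_of_isBounded withSeminorms withSeminorms _ ?_
    intro p
    have hp : IsStepwiseContinuous (p.1.comp (partialLM i)) := by
      intro k
      obtain ⟨m, C, h⟩ := p.2 k
      refine ⟨m + 1, C, fun f hf B hB => h (partialLM i f) (inStep_partial hf i) B fun j hj => ?_⟩
      exact weightedBound_partial hf.1 i (hB (j + 1) (by omega))
    refine ⟨{⟨_, hp⟩}, 1, ?_⟩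
    simp only [Finset.sup_singleton, one_smul]
    exact le_rfl

end OC

/-! ### The complex `(Ω(𝕋², 𝒲), Q)` -/

/-- The smooth sections of the trivial bundle `𝒲` over the torus with fibre `𝒪_C(ℝ²)`. -/
def Sections : Type := smoothTorus OC

namespace Sections

instance : AddCommGroup Sections := inferInstanceAs (AddCommGroup (smoothTorus OC))

instance : Module ℂ Sections := inferInstanceAs (Module ℂ (smoothTorus OC))

/-- The value of a section at a point of the torus, an element of the fibre `𝒪_C(ℝ²)`. -/
def val (F : Sections) (x : Torus2) : OC := Subtype.val F x

end Sections

/-- The operator `∂/∂xⁱ - ∂/∂yⁱ` on sections of `𝒲`. -/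
def secD (i : Fin 2) : Sections →ₗ[ℂ] Sections :=
  (torusPartial i - smoothTorusMap (OC.partialY i) : smoothTorus OC →ₗ[ℂ] smoothTorus OC)

/-- The `𝒲`-valued differential forms of degree `p` on the torus. In the global frame
`∂/∂x¹, ∂/∂x²` such a form is an alternating map from `p` vectors in `ℝ²` to sections of `𝒲`. -/
abbrev Forms (p : ℕ) : Type := Plane [⋀^Fin p]→ₗ[ℝ] Sections

/-- `∂/∂xⁱ - ∂/∂yⁱ` applied to the coefficients of a form. -/
def formD (p : ℕ) (i : Fin 2) : Forms p →ₗ[ℂ] Forms p where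
  toFun η := ((secD i).restrictScalars ℝ).compAlternatingMap η
  map_add' η θ := by ext; simp
  map_smul' c η := by ext; simp

/-- The exterior product `η ↦ dxⁱ ∧ η`. On vectors `v₀, …, v_p` it is
`∑ⱼ (-1)ʲ dxⁱ(vⱼ) η(v₀, …, v_{j-1}, v_{j+1}, …, v_p)`. -/
def dxWedge (p : ℕ) (i : Fin 2) : Forms p →ₗ[ℂ] Forms (p + 1) where
  toFun η := AlternatingMap.alternatizeUncurryFin
    ((EuclideanSpace.proj i : Plane →L[ℝ] ℝ).toLinearMap.smulRight η)
  map_add' η θ := by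
    rw [← AlternatingMap.alternatizeUncurryFin_add]
    congr 1
    ext1 v
    simp
  map_smul' c η := by
    rw [RingHom.id_apply, ← AlternatingMap.alternatizeUncurryFin_smul]
    congr 1
    ext1 v
    exact (smul_comm _ _ _)

/-- The differential `Q = dxⁱ ∧ (∂/∂xⁱ - ∂/∂yⁱ)`. -/
def Q (p : ℕ) : Forms p →ₗ[ℂ] Forms (p + 1) :=
  ∑ i, dxWedge p i ∘ₗ formD p i

/-- The `Q`-closed forms of degree `p`. -/
def cocycles (p : ℕ) : Submodule ℂ (Forms p) := LinearMap.ker (Q p)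

/-- The `Q`-exact forms of degree `p`; in degree `0` there is only the form `0`. -/
def coboundaries : (p : ℕ) → Submodule ℂ (Forms p)
  | 0 => ⊥
  | p + 1 => LinearMap.range (Q p)

/-- The `p`-th cohomology of `(Ω(𝕋², 𝒲), Q)`: closed forms modulo exact forms. -/
abbrev Cohomology (p : ℕ) : Type :=
  cocycles p ⧸ (coboundaries p).submoduleOf (cocycles p)

/-- The cohomology class of a closed form. -/
def cohomologyClass {p : ℕ} (η : cocycles p) : Cohomology p :=
  Submodule.Quotient.mk η

/-- A form of degree `0` as a function of `x` in the torus and `y` in the plane. -/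
def formFun (η : Forms 0) (x : Torus2) (y : Plane) : ℂ := (η ![]).val x y

end

/-!
Along the leaves of the foliation spanned by the commuting operators `Dᵢ = ∂/∂xⁱ - ∂/∂yⁱ`, the
complex `(Ω(𝕋², 𝒲), Q)` is a de Rham complex, and it is the Koszul complex of `D₀, D₁`. It is
therefore acyclic as soon as each `Dᵢ` has a right inverse on sections that preserves the kernel of
the other one (`exists_secD_eq`): this makes the top cohomology vanish at once, and in degree one it
allows to solve the two equations one after the other. In degree zero, a section killed by `D₀` and
`D₁` is constant along the leaves `(x + v, y - v)`, hence determined by its restriction to `y = 0`.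

The analytic point is that solutions must again be smooth maps into `𝒪_C(ℝ²)`. A smooth function
on `𝕋² × ℝ²` is a smooth section of `𝒲` if and only if `∂_x^a ∂_y^b` of it is bounded by a multiple
of `(1+|y|²)^K`, with an exponent `K` that may depend on `a` but not on `b` (`TemperedFamily`,
`exists_temperedFamily`, `TemperedFamily.toSection`).

* That sections have this property rests on the regularity of the inductive limit `𝒪_C(ℝ²)`: a
  compact family lies in one step and is bounded there (`OC.exists_uniform_growth`). If all
  functions of the family are `O((1+|y|²)^K)` but their `j`-th derivatives are not uniformly
  `O((1+|y|²)^(K+1))`, then these are badly approximated at points `yₙ` by finite differences of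
  mesh `r` with `r^j = (1+|yₙ|²)⁻¹`. When the `n`-th difference is exact up to order `n + j`, the
  errors of these approximations, suitably normalized, form a sequence of functionals that is
  eventually equicontinuous on each step; its supremum is thus a continuous seminorm on
  `𝒪_C(ℝ²)`, unbounded on the family, which is impossible.
* Since the exponent for `∂_x^a` may really grow with `|a|`, integration of a section along the
  leaves from the base point `y = 0` need not give a section: the derivatives in `y` of such an
  integral involve derivatives in `x` of the section of arbitrarily high order. Instead a smooth
  cutoff `χ(yⁱ)` splits the section into two parts supported in opposite half-planes, and
  `Dᵢ Ψ = ±Φ` is solved for each part by integration over the whole half-line on which it may be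
  nonzero. This integration commutes with all `∂_x` and `∂_y` (`TemperedFamily.rayIntegral`).
-/

noncomputable section

/-! ### Functions on the plane given with all their partial derivatives -/

/-- A function of two real variables with continuous partial derivatives is differentiable. -/
theorem hasFDerivAt_of_partials {ψ ψ₁ ψ₂ : ℝ → ℝ → ℂ}
    (h₁ : ∀ s t, HasDerivAt (fun s => ψ s t) (ψ₁ s t) s)
    (h₂ : ∀ s t, HasDerivAt (fun t => ψ s t) (ψ₂ s t) t)
    (c₁ : Continuous fun p : ℝ × ℝ => ψ₁ p.1 p.2) (c₂ : Continuous fun p : ℝ × ℝ => ψ₂ p.1 p.2)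
    (p : ℝ × ℝ) : HasFDerivAt (fun p : ℝ × ℝ => ψ p.1 p.2)
      ((ContinuousLinearMap.toSpanSingleton ℝ (ψ₁ p.1 p.2)).coprod
        (ContinuousLinearMap.toSpanSingleton ℝ (ψ₂ p.1 p.2))) p := by
  have c : Continuous fun z : ℂ => ContinuousLinearMap.toSpanSingleton ℝ z :=
    (ContinuousLinearMap.toSpanSingletonCLE (𝕜 := ℝ) (E := ℂ)).continuous
  exact (hasStrictFDerivAt_uncurry_coprod (u := p) (f := ψ)
    (f₁ := fun s t => ContinuousLinearMap.toSpanSingleton ℝ (ψ₁ s t))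
    (f₂ := fun s t => ContinuousLinearMap.toSpanSingleton ℝ (ψ₂ s t))
    (Eventually.of_forall fun v => (h₁ v.1 v.2).hasFDerivAt)
    (Eventually.of_forall fun v => (h₂ v.1 v.2).hasFDerivAt)
    (c.comp c₁).continuousAt (c.comp c₂).continuousAt).hasFDerivAt

theorem eq_sum_stdVec (v : Plane) : v = v 0 • stdVec 0 + v 1 • stdVec 1 := by
  ext j
  fin_cases j <;> simp [stdVec]

/-- Induction on multi-indices, one unit vector at a time. -/
theorem multiIndex_induction {P : (Fin 2 → ℕ) → Prop} (h0 : P 0)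
    (hs : ∀ a i, P a → P (a + Pi.single i 1)) (a : Fin 2 → ℕ) : P a := by
  have h1 : ∀ n : ℕ, P (n • Pi.single 0 1) := fun n => by
    induction n with
    | zero => simpa using h0
    | succ n ih => rw [succ_nsmul]; exact hs _ _ ih
  have h2 : ∀ m n : ℕ, P (m • Pi.single 0 1 + n • Pi.single 1 1) := fun m n => by
    induction n with
    | zero => simpa using h1 m
    | succ n ih => rw [succ_nsmul, ← add_assoc]; exact hs _ _ ih
  convert h2 (a 0) (a 1) using 1
  ext i
  fin_cases i <;> simp

theorem finite_multiIndex (m : ℕ) : {b : Fin 2 → ℕ | b 0 + b 1 ≤ m}.Finite := by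
  refine (Set.finite_Iic (fun _ : Fin 2 => m)).subset fun b hb i => ?_
  have : b 0 + b 1 ≤ m := hb
  fin_cases i <;> simp <;> omega

/-- A function `g 0` on the plane given together with all its partial derivatives `g b = ∂^b g 0`,
which are required to be continuous. -/
structure PartialFamily (g : (Fin 2 → ℕ) → Plane → ℂ) : Prop where
  continuous : ∀ b, Continuous (g b)
  hasDerivAt : ∀ b i y, HasDerivAt (fun t : ℝ => g b (y + t • stdVec i)) (g (b + Pi.single i 1) y) 0

namespace PartialFamily

variable {g : (Fin 2 → ℕ) → Plane → ℂ}

theorem hasDerivAt_line (hg : PartialFamily g) (b : Fin 2 → ℕ) (i : Fin 2) (y : Plane) (t : ℝ) :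
    HasDerivAt (fun t : ℝ => g b (y + t • stdVec i))
      (g (b + Pi.single i 1) (y + t • stdVec i)) t := by
  have h := hg.hasDerivAt b i (y + t • stdVec i)
  rw [← sub_self t] at h
  have h2 := h.comp_sub_const t t
  refine h2.congr_of_eventuallyEq (Eventually.of_forall fun s => ?_)
  simp only [add_assoc, ← add_smul]
  congr 3
  ring

theorem hasFDerivAt (hg : PartialFamily g) (b : Fin 2 → ℕ) (y : Plane) :
    HasFDerivAt (g b) (∑ i, ContinuousLinearMap.smulRightL ℝ Plane ℂ (EuclideanSpace.proj i)
      (g (b + Pi.single i 1) y)) y := by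
  have hc : ∀ b', Continuous fun p : ℝ × ℝ => g b' (p.1 • stdVec 0 + p.2 • stdVec 1) := fun b' =>
    (hg.continuous b').comp (by fun_prop)
  have h := hasFDerivAt_of_partials (ψ := fun s t => g b (s • stdVec 0 + t • stdVec 1))
    (ψ₁ := fun s t => g (b + Pi.single 0 1) (s • stdVec 0 + t • stdVec 1))
    (ψ₂ := fun s t => g (b + Pi.single 1 1) (s • stdVec 0 + t • stdVec 1))
    (fun s t => by
      have := hg.hasDerivAt_line b 0 (t • stdVec 1) s
      simpa only [add_comm (t • stdVec 1)] using this)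
    (fun s t => hg.hasDerivAt_line b 1 (s • stdVec 0) t) (hc _) (hc _)
  set L : Plane →L[ℝ] ℝ × ℝ := (EuclideanSpace.proj 0 : Plane →L[ℝ] ℝ).prod (EuclideanSpace.proj 1)
  have h2 := (h (L y)).comp y L.hasFDerivAt
  have he : ∀ v : Plane, (L v).1 • stdVec 0 + (L v).2 • stdVec 1 = v := fun v =>
    (eq_sum_stdVec v).symm
  have hf : (fun p : ℝ × ℝ => g b (p.1 • stdVec 0 + p.2 • stdVec 1)) ∘ L = g b :=
    funext fun v => by simp only [Function.comp_apply, he]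
  rw [hf] at h2
  refine h2.congr_fderiv ?_
  ext v
  simp only [he]
  simp [L, ContinuousLinearMap.smulRightL]

theorem fderiv_eq (hg : PartialFamily g) (b : Fin 2 → ℕ) : fderiv ℝ (g b) = fun y =>
    ∑ i, ContinuousLinearMap.smulRightL ℝ Plane ℂ (EuclideanSpace.proj i)
      (g (b + Pi.single i 1) y) :=
  funext fun y => (hg.hasFDerivAt b y).fderiv

theorem contDiff (hg : PartialFamily g) (b : Fin 2 → ℕ) : ContDiff ℝ ∞ (g b) := by
  refine contDiff_infty.2 fun n => ?_
  induction n generalizing b with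
  | zero => exact contDiff_zero.2 (hg.continuous b)
  | succ n ih =>
    refine (contDiff_succ_iff_fderiv (n := n)).2
      ⟨fun y => (hg.hasFDerivAt b y).differentiableAt, by simp, ?_⟩
    rw [hg.fderiv_eq]
    exact ContDiff.sum fun i _ => (ContinuousLinearMap.contDiff _).comp (ih _)

/-- The partial derivatives of order `j` control the `j`-th iterated Fréchet derivative. -/
theorem norm_iteratedFDeriv_le (hg : PartialFamily g) (y : Plane) {B : ℝ} :
    ∀ (j : ℕ) (b : Fin 2 → ℕ),
    (∀ c : Fin 2 → ℕ, c 0 + c 1 = j → ‖g (b + c) y‖ ≤ B) →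
    ‖iteratedFDeriv ℝ j (g b) y‖ ≤ 2 ^ j * B := by
  intro j
  induction j with
  | zero =>
    intro b h
    simpa using h 0 rfl
  | succ j ih =>
    intro b h
    rw [← norm_iteratedFDeriv_fderiv, hg.fderiv_eq]
    have hc : ∀ i ∈ (Finset.univ : Finset (Fin 2)), ContDiff ℝ j fun y =>
        ContinuousLinearMap.smulRightL ℝ Plane ℂ (EuclideanSpace.proj i)
          (g (b + Pi.single i 1) y) :=
      fun i _ => (ContinuousLinearMap.contDiff _).comp ((hg.contDiff _).of_le (mod_cast le_top))
    rw [iteratedFDeriv_sum hc, Finset.sum_apply]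
    have hb : ∀ i ∈ (Finset.univ : Finset (Fin 2)), ‖iteratedFDeriv ℝ j (fun y =>
        ContinuousLinearMap.smulRightL ℝ Plane ℂ (EuclideanSpace.proj i)
          (g (b + Pi.single i 1) y)) y‖ ≤ 2 ^ j * B := by
      intro i _
      refine (ContinuousLinearMap.norm_iteratedFDeriv_comp_left _
        ((hg.contDiff (b + Pi.single i 1)).contDiffAt (x := y)) (n := j) (N := ∞)
        (mod_cast le_top)).trans ?_
      have h1 : ‖ContinuousLinearMap.smulRightL ℝ Plane ℂ (EuclideanSpace.proj i)‖ ≤ 1 := by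
        refine ContinuousLinearMap.opNorm_le_bound _ zero_le_one fun c => ?_
        change ‖ContinuousLinearMap.smulRight _ c‖ ≤ _
        rw [ContinuousLinearMap.norm_smulRight_apply]
        gcongr
        refine ContinuousLinearMap.opNorm_le_bound _ zero_le_one fun v => ?_
        rw [one_mul]
        exact PiLp.norm_apply_le v i
      refine (mul_le_of_le_one_left (norm_nonneg _) h1).trans (ih _ fun c hc => ?_)
      rw [add_assoc]
      refine h _ ?_
      fin_cases i <;> simp <;> omega
    refine (norm_sum_le_of_le _ hb).trans ?_
    simp [pow_succ]
    linarith

theorem weightedBound (hg : PartialFamily g) {K j : ℕ} {B : ℝ}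
    (h : ∀ c : Fin 2 → ℕ, c 0 + c 1 = j → ∀ y, ‖g c y‖ ≤ B * (1 + ‖y‖ ^ 2) ^ K) :
    WeightedBound (-K) j (g 0) (2 ^ j * B) := by
  intro y
  rw [zpow_neg, zpow_natCast, inv_mul_eq_div, div_le_iff₀ (by positivity), mul_assoc]
  refine hg.norm_iteratedFDeriv_le y j 0 fun c hc => ?_
  rw [zero_add]
  exact h c hc y

theorem inStep (hg : PartialFamily g) {K : ℕ}
    (h : ∀ b, ∃ C : ℝ, ∀ y, ‖g b y‖ ≤ C * (1 + ‖y‖ ^ 2) ^ K) : InStep (-K) (g 0) := by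
  refine ⟨hg.contDiff 0, fun j => ?_⟩
  choose C hC using h
  have hfin : {b : Fin 2 → ℕ | b 0 + b 1 ≤ j}.Finite := finite_multiIndex j
  refine ⟨2 ^ j * ∑ b ∈ hfin.toFinset, |C b|, hg.weightedBound fun c hc y => (hC c y).trans ?_⟩
  gcongr
  refine (le_abs_self _).trans (Finset.single_le_sum (f := fun b => |C b|)
    (fun b _ => abs_nonneg _) ?_)
  simp only [Set.Finite.mem_toFinset, Set.mem_ofPred_eq]
  omega

end PartialFamily

/-! ### Partial derivatives on `𝒪_C(ℝ²)` -/

namespace OC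

theorem add_apply (f g : OC) (y : Plane) : (f + g) y = f y + g y := rfl

theorem sub_apply (f g : OC) (y : Plane) : (f - g) y = f y - g y := rfl

theorem smul_apply (c : ℂ) (f : OC) (y : Plane) : (c • f) y = c * f y := rfl

theorem differentiableAt (f : OC) (y : Plane) : DifferentiableAt ℝ f.val y :=
  (f.contDiff.differentiable (by simp)).differentiableAt

theorem hasDerivAt_line (f : OC) (i : Fin 2) (y : Plane) (t : ℝ) :
    HasDerivAt (fun t : ℝ => f (y + t • stdVec i)) (partialY i f (y + t • stdVec i)) t := by
  have h1 : HasDerivAt (fun t : ℝ => y + t • stdVec i) (stdVec i) t := by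
    simpa using ((hasDerivAt_id t).smul_const (stdVec i)).const_add y
  exact (f.differentiableAt (y + t • stdVec i)).hasFDerivAt.comp_hasDerivAt t h1

theorem partialY_comm (i j : Fin 2) (f : OC) :
    partialY i (partialY j f) = partialY j (partialY i f) := by
  have key : ∀ (i j : Fin 2) (y : Plane), partialY i (partialY j f) y =
      fderiv ℝ (fderiv ℝ f.val) y (stdVec i) (stdVec j) := by
    intro i j y
    have hd : DifferentiableAt ℝ (fderiv ℝ f.val) y :=
      ((f.contDiff.fderiv_right (m := ∞) (by simp)).differentiable (by simp)).differentiableAt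
    change fderiv ℝ (fun y => fderiv ℝ f.val y (stdVec j)) y (stdVec i) = _
    rw [fderiv_clm_apply hd (differentiableAt_const _)]
    simp
  refine ext fun y => ?_
  rw [key, key]
  have hs : IsSymmSndFDerivAt ℝ f.val y :=
    f.contDiff.contDiffAt.isSymmSndFDerivAt (by simpa using
      (WithTop.coe_le_coe.2 (le_top : (2 : ℕ∞) ≤ ⊤)))
  exact hs _ _

/-- The operator `∂^b` on `𝒪_C(ℝ²)`, for a multi-index `b`. -/
def dy (b : Fin 2 → ℕ) : OC →L[ℂ] OC := partialY 0 ^ b 0 * partialY 1 ^ b 1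

theorem commute_partialY (i j : Fin 2) : Commute (partialY i) (partialY j) :=
  ContinuousLinearMap.ext fun f => partialY_comm i j f

theorem dy_add_single (b : Fin 2 → ℕ) (i : Fin 2) :
    dy (b + Pi.single i 1) = partialY i * dy b := by
  fin_cases i
  · simp [dy, pow_succ', mul_assoc]
  · have h : Commute (partialY 1) (partialY 0 ^ b 0) := (commute_partialY 1 0).pow_right _
    simp only [dy, Fin.mk_one, Pi.add_apply, Pi.single_eq_same, pow_succ']
    rw [← mul_assoc (partialY 1), h.eq]
    simp [mul_assoc]

theorem dy_add_single_apply (b : Fin 2 → ℕ) (i : Fin 2) (f : OC) :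
    dy (b + Pi.single i 1) f = partialY i (dy b f) := by rw [dy_add_single]; rfl

theorem partialFamily_dy (f : OC) : PartialFamily fun b => (dy b f).val where
  continuous b := (dy b f).contDiff.continuous
  hasDerivAt b i y := by
    simpa [dy_add_single_apply] using hasDerivAt_line (dy b f) i y 0

theorem weightedBound_partialY_pow {k : ℤ} {B : ℝ} (i : Fin 2) (n : ℕ) : ∀ (j : ℕ) (f : OC),
    WeightedBound k (j + n) f.val B → WeightedBound k j ((partialY i ^ n) f).val B := by
  induction n with
  | zero => intro j f h; exact h
  | succ n ih =>
    intro j f h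
    rw [pow_succ']
    exact weightedBound_partial (contDiff _) i (ih (j + 1) f (by rwa [add_right_comm]))

theorem weightedBound_zero_iff {K : ℕ} {f : Plane → ℂ} {B : ℝ} :
    WeightedBound (-K) 0 f B ↔ ∀ y, ‖f y‖ ≤ B * (1 + ‖y‖ ^ 2) ^ K := by
  refine forall_congr' fun y => ?_
  rw [norm_iteratedFDeriv_zero, zpow_neg, zpow_natCast, inv_mul_eq_div, div_le_iff₀ (by positivity)]

/-- Convergence to `0` in `𝒪_C(ℝ²)` follows from convergence to `0` in one of the steps. -/
theorem tendsto_zero_of_dy {τ : Type*} {l : Filter τ} {g : τ → OC} (K : ℕ)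
    (h : ∀ b, ∃ ε : τ → ℝ, Tendsto ε l (𝓝 0) ∧
      ∀ᶠ t in l, ∀ y, ‖dy b (g t) y‖ ≤ ε t * (1 + ‖y‖ ^ 2) ^ K)
    (hg : ∀ t, InStep (-K) (g t).val) : Tendsto g l (𝓝 0) := by
  rw [withSeminorms.tendsto_nhds]
  rintro ⟨p, hp⟩ e he
  obtain ⟨m, C, hmC⟩ := hp (-K)
  choose ε hε hb using h
  set s := (finite_multiIndex m).toFinset
  set E : τ → ℝ := fun t => ∑ b ∈ s, |ε b t|
  have hE : Tendsto (fun t => C * (2 ^ m * E t)) l (𝓝 0) := by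
    have : Tendsto E l (𝓝 (∑ b ∈ s, |(0 : ℝ)|)) := tendsto_finsetSum _ fun b _ => (hε b).abs
    simpa using (this.const_mul (2 ^ m)).const_mul C
  have hall : ∀ᶠ t in l, ∀ b ∈ s, ∀ y, ‖dy b (g t) y‖ ≤ ε b t * (1 + ‖y‖ ^ 2) ^ K :=
    (Finset.eventually_all s).2 fun b _ => hb b
  filter_upwards [hall, hE.eventually (gt_mem_nhds he)] with t ht hlt
  rw [sub_zero]
  refine lt_of_le_of_lt (hmC (g t) (hg t) (2 ^ m * E t) fun j hj => ?_) hlt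
  have hEt : 0 ≤ E t := Finset.sum_nonneg fun b _ => abs_nonneg _
  have h1 : WeightedBound (-K) j (g t).val (2 ^ j * E t) := by
    refine (g t).partialFamily_dy.weightedBound fun b hb y => ?_
    have hbs : b ∈ s := by simp only [s, Set.Finite.mem_toFinset, Set.mem_ofPred_eq]; omega
    refine (ht b hbs y).trans ?_
    gcongr
    exact (le_abs_self _).trans
      (Finset.single_le_sum (f := fun b => |ε b t|) (fun b _ => abs_nonneg _) hbs)
  refine fun y => (h1 y).trans ?_
  gcongr
  norm_num

/-- Evaluation at a point, as a continuous linear functional. -/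
def evalL (y : Plane) : OC →L[ℂ] ℂ where
  toFun f := f y
  map_add' _ _ := rfl
  map_smul' _ _ := rfl
  cont := by
    have h := (withSeminorms.continuous_seminorm ⟨_, isStepwiseContinuous_evalSeminorm y⟩)
    have h0 := h.tendsto 0
    let L : OC →ₗ[ℂ] ℂ := ⟨⟨fun f => f y, fun _ _ => rfl⟩, fun _ _ => rfl⟩
    refine continuous_of_continuousAt_zero L ?_
    refine tendsto_zero_iff_norm_tendsto_zero.2 ?_ |>.trans_eq (by rw [map_zero])
    rwa [map_zero] at h0

theorem evalL_apply (y : Plane) (f : OC) : evalL y f = f y := rfl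

end OC

/-! ### Finite differences of high order -/

/-- Finite difference coefficients for the `j`-th derivative, exact up to order `N`. -/
theorem exists_finiteDiff_coeff (j N : ℕ) : ∃ c : ℕ → ℝ, ∀ l ≤ N,
    ∑ i ∈ Finset.range (N + 1), c i * (i : ℝ) ^ l = if l = j then 1 else 0 := by
  classical
  -- `∑ i, c i * P i` is to be the `j`-th coefficient of the polynomial `P`, for `P` of degree `≤ N`.
  refine ⟨fun i => (Lagrange.basis (Finset.range (N + 1)) (fun i : ℕ => (i : ℝ)) i).coeff j,
    fun l hl => ?_⟩
  have hinj : Set.InjOn (fun i : ℕ => (i : ℝ)) (Finset.range (N + 1)) :=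
    fun a _ b _ h => Nat.cast_injective h
  have h := Lagrange.eq_interpolate (f := (Polynomial.X ^ l : Polynomial ℝ)) hinj (by
    rw [Polynomial.degree_X_pow, Finset.card_range]
    exact_mod_cast Nat.lt_succ_of_le hl)
  have h2 := congrArg (fun p => Polynomial.coeff p j) h
  simp only [Lagrange.interpolate_apply, Polynomial.finsetSum_coeff, Polynomial.coeff_C_mul,
    Polynomial.eval_pow, Polynomial.eval_X, Polynomial.coeff_X_pow] at h2
  simp only [eq_comm (a := l)]
  rw [h2]
  exact Finset.sum_congr rfl fun i _ => mul_comm _ _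

/-- Taylor's formula for a function given together with all its derivatives. -/
theorem norm_sub_taylor_le {T B : ℝ} (m : ℕ) : ∀ (g : ℕ → ℝ → ℂ),
    (∀ l t, HasDerivAt (g l) (g (l + 1) t) t) → (∀ t ∈ Set.Icc 0 T, ‖g m t‖ ≤ B) →
    ∀ t ∈ Set.Icc 0 T,
      ‖g 0 t - ∑ l ∈ Finset.range m, ((t ^ l / l.factorial : ℝ) : ℂ) * g l 0‖ ≤ B * t ^ m := by
  induction m with
  | zero => intro g _ hB t ht; simpa using hB t ht
  | succ m ih =>
    intro g hg hB t ht
    have hB0 : 0 ≤ B := (norm_nonneg _).trans (hB t ht)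
    set P : ℝ → ℂ := fun s =>
      g 0 s - ∑ l ∈ Finset.range (m + 1), ((s ^ l / l.factorial : ℝ) : ℂ) * g l 0 with hP
    set P' : ℝ → ℂ := fun s =>
      g 1 s - ∑ l ∈ Finset.range m, ((s ^ l / l.factorial : ℝ) : ℂ) * g (l + 1) 0 with hP'
    have hder : ∀ s, HasDerivAt P (P' s) s := by
      intro s
      simp only [hP, hP', Finset.sum_range_succ']
      refine (hg 0 s).sub ?_
      have h0 : HasDerivAt (fun s : ℝ => (((s ^ 0 / (Nat.factorial 0) : ℝ) : ℂ)) * g 0 0) 0 s := by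
        simpa using hasDerivAt_const s (g 0 0)
      have h1 : HasDerivAt (fun s : ℝ => ∑ l ∈ Finset.range m,
          ((s ^ (l + 1) / (l + 1).factorial : ℝ) : ℂ) * g (l + 1) 0)
          (∑ l ∈ Finset.range m, ((s ^ l / l.factorial : ℝ) : ℂ) * g (l + 1) 0) s := by
        refine HasDerivAt.fun_sum fun l _ => ?_
        refine HasDerivAt.mul_const ?_ _
        have := ((hasDerivAt_pow (l + 1) s).div_const ((l + 1).factorial : ℝ)).ofReal_comp
        have hl : ((l + 1 : ℕ) : ℝ) * s ^ (l + 1 - 1) / (l + 1).factorial = s ^ l / l.factorial := by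
          rw [Nat.factorial_succ, Nat.add_sub_cancel]
          push_cast
          field_simp
        rwa [hl] at this
      simpa only [add_zero] using h1.fun_add h0
    have hbd : ∀ s ∈ Set.Ico 0 t, ‖P' s‖ ≤ B * t ^ m := by
      intro s hs
      have hsT : s ∈ Set.Icc 0 T := ⟨hs.1, hs.2.le.trans ht.2⟩
      refine (ih (fun l => g (l + 1)) (fun l => hg (l + 1)) hB s hsT).trans ?_
      exact mul_le_mul_of_nonneg_left (pow_le_pow_left₀ hs.1 hs.2.le m) hB0
    have h := norm_image_sub_le_of_norm_deriv_le_segment' (f := P) (f' := P') (a := 0) (b := t)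
      (fun s _ => (hder s).hasDerivWithinAt) hbd t ⟨ht.1, le_rfl⟩
    have hP0 : P 0 = 0 := by simp [hP, Finset.sum_range_succ']
    rw [hP0, sub_zero, sub_zero] at h
    rw [pow_succ, ← mul_assoc]
    exact h

/-- The error of the `j`-th finite difference, when used on functions with `m` derivatives for any
`m` below the order of exactness. -/
theorem norm_finiteDiff_sub_le {j N m : ℕ} {c : ℕ → ℝ} (hc : ∀ l ≤ N,
    ∑ i ∈ Finset.range (N + 1), c i * (i : ℝ) ^ l = if l = j then 1 else 0)
    (hm : m ≤ N) (hj : j < m) {g : ℕ → ℝ → ℂ} (hg : ∀ l t, HasDerivAt (g l) (g (l + 1) t) t)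
    {r B : ℝ} (hr : 0 ≤ r) (hB : ∀ t ∈ Set.Icc 0 (N * r), ‖g m t‖ ≤ B) :
    ‖∑ i ∈ Finset.range (N + 1), (c i : ℂ) * g 0 (i * r) - ((r ^ j / j.factorial : ℝ) : ℂ) * g j 0‖
      ≤ B * r ^ m * ∑ i ∈ Finset.range (N + 1), |c i| * (i : ℝ) ^ m := by
  have h1 : ∑ i ∈ Finset.range (N + 1), (c i : ℂ) *
      ∑ l ∈ Finset.range m, (((i * r) ^ l / l.factorial : ℝ) : ℂ) * g l 0 =
      ((r ^ j / j.factorial : ℝ) : ℂ) * g j 0 := by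
    simp only [Finset.mul_sum]
    rw [Finset.sum_comm]
    have h2 : ∀ l ∈ Finset.range m, ∑ i ∈ Finset.range (N + 1),
        (c i : ℂ) * ((((i * r) ^ l / l.factorial : ℝ) : ℂ) * g l 0) =
        (((if l = j then 1 else 0 : ℝ)) : ℂ) * (((r ^ l / l.factorial : ℝ) : ℂ) * g l 0) := by
      intro l hl
      rw [← hc l ((Finset.mem_range.1 hl).le.trans hm)]
      push_cast
      rw [Finset.sum_mul]
      refine Finset.sum_congr rfl fun i _ => ?_
      rw [mul_pow]
      ring
    rw [Finset.sum_congr rfl h2, Finset.sum_eq_single j]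
    · simp
    · intro l _ hl; simp [hl]
    · intro h; exact absurd (Finset.mem_range.2 hj) h
  rw [← h1, ← Finset.sum_sub_distrib, Finset.mul_sum]
  refine norm_sum_le_of_le _ fun i hi => ?_
  rw [← mul_sub, norm_mul, Complex.norm_real, Real.norm_eq_abs]
  have hiN : (i : ℝ) ≤ N := by exact_mod_cast Nat.lt_succ_iff.1 (Finset.mem_range.1 hi)
  have h3 := norm_sub_taylor_le m g hg hB (i * r)
    ⟨by positivity, mul_le_mul_of_nonneg_right hiN hr⟩
  refine (mul_le_mul_of_nonneg_left h3 (abs_nonneg _)).trans_eq ?_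
  rw [mul_pow]
  ring

/-! ### Regularity of the inductive limit `𝒪_C(ℝ²)` -/

theorem WeightedBound.nonneg {k : ℤ} {j : ℕ} {f : Plane → ℂ} {B : ℝ}
    (h : WeightedBound k j f B) : 0 ≤ B := le_trans (by positivity) (h 0)

namespace OC

theorem exists_weightedBound {k : ℤ} {f : OC} (hf : InStep k f.val) (m : ℕ) :
    ∃ B, ∀ j ≤ m, WeightedBound k j f.val B := by
  choose B hB using hf.2
  refine ⟨∑ j ∈ Finset.range (m + 1), |B j|, fun j hj y => (hB j y).trans ?_⟩
  exact (le_abs_self _).trans (Finset.single_le_sum (f := fun j => |B j|)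
    (fun _ _ => abs_nonneg _) (Finset.mem_range.2 (by omega)))

theorem isStepwiseContinuous_of_continuous {p : Seminorm ℂ OC} (hp : Continuous p) :
    IsStepwiseContinuous p := by
  obtain ⟨s, C, -, hs⟩ := Seminorm.bound_of_continuous withSeminorms p hp
  intro k
  choose m C' h using fun q : {p : Seminorm ℂ OC // IsStepwiseContinuous p} => q.2 k
  refine ⟨s.sup m, C * ∑ q ∈ s, C' q, fun f hf B hB => ?_⟩
  calc p f ≤ C * (s.sup seminorms) f := hs f
    _ ≤ C * ∑ q ∈ s, seminorms q f := by
        refine mul_le_mul_of_nonneg_left ?_ C.2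
        have := Seminorm.finset_sup_le_sum seminorms s f
        simpa using this
    _ ≤ C * ∑ q ∈ s, C' q * B := by
        refine mul_le_mul_of_nonneg_left (Finset.sum_le_sum fun q hq => ?_) C.2
        exact h q f hf B fun j hj => hB j (hj.trans (Finset.le_sup hq))
    _ = _ := by rw [← Finset.sum_mul, mul_assoc]

/-- A sequence of continuous linear functionals on `𝒪_C(ℝ²)` that is, up to finitely many terms,
equicontinuous on each step, is bounded on compact families. -/
theorem exists_bound_functionals {X : Type*} [TopologicalSpace X] [CompactSpace X] {G : X → OC}
    (hG : Continuous G) (ℓ : ℕ → OC →L[ℂ] ℂ)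
    (h : ∀ M : ℕ, ∃ (N m : ℕ) (C : ℝ), ∀ n ≥ N, ∀ (f : OC) (B : ℝ),
      (∀ j ≤ m, WeightedBound (-M) j f.val B) → ‖ℓ n f‖ ≤ C * B) :
    ∃ C, ∀ n x, ‖ℓ n (G x)‖ ≤ C := by
  have key : ∀ k : ℤ, ∃ (m : ℕ) (C : ℝ), ∀ n, ∀ f : OC, InStep k f.val →
      ∀ B : ℝ, (∀ j ≤ m, WeightedBound k j f.val B) → ‖ℓ n f‖ ≤ C * B := by
    intro k
    obtain ⟨N, m, C, hN⟩ := h k.natAbs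
    have hn : ∀ n, IsStepwiseContinuous ((normSeminorm ℂ ℂ).comp (ℓ n).toLinearMap) := fun n =>
      isStepwiseContinuous_of_continuous (continuous_norm.comp (ℓ n).continuous)
    choose m' C' h' using fun n => hn n k
    refine ⟨m + (Finset.range N).sup m', |C| + ∑ n ∈ Finset.range N, |C' n|,
      fun n f hf B hB => ?_⟩
    have hB0 : 0 ≤ B := WeightedBound.nonneg (hB 0 (Nat.zero_le _))
    have hS : 0 ≤ ∑ n ∈ Finset.range N, |C' n| := Finset.sum_nonneg fun _ _ => abs_nonneg _
    rcases le_or_gt N n with hle | hlt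
    · refine (hN n hle f B fun j hj => ?_).trans ?_
      · exact (hB j (by omega)).mono (by omega)
      · refine mul_le_mul_of_nonneg_right ?_ hB0
        linarith [le_abs_self C]
    · have hmem := Finset.mem_range.2 hlt
      refine (h' n f hf B fun j hj => hB j ?_).trans ?_
      · exact (hj.trans (Finset.le_sup hmem)).trans (Nat.le_add_left _ _)
      · refine mul_le_mul_of_nonneg_right ?_ hB0
        have := Finset.single_le_sum (f := fun n => |C' n|) (fun _ _ => abs_nonneg _) hmem
        linarith [le_abs_self (C' n), abs_nonneg C]
  have hbdd : ∀ f : OC, BddAbove (Set.range fun n => ‖ℓ n f‖) := by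
    intro f
    obtain ⟨k, hk⟩ := f.exists_inStep
    obtain ⟨m, C, hC⟩ := key k
    obtain ⟨B, hB⟩ := exists_weightedBound hk m
    exact ⟨C * B, by rintro _ ⟨n, rfl⟩; exact hC n f hk B hB⟩
  let p : Seminorm ℂ OC := Seminorm.of (fun f => ⨆ n, ‖ℓ n f‖)
    (fun f g => by
      refine ciSup_le fun n => ?_
      rw [map_add]
      exact (norm_add_le _ _).trans (add_le_add (le_ciSup (hbdd f) n) (le_ciSup (hbdd g) n)))
    (fun c f => by
      simp only [map_smul, norm_smul]
      exact (Real.mul_iSup_of_nonneg (norm_nonneg c) _).symm)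
  have hp : IsStepwiseContinuous p := by
    intro k
    obtain ⟨m, C, hC⟩ := key k
    exact ⟨m, C, fun f hf B hB => ciSup_le fun n => hC n f hf B hB⟩
  have hpc : Continuous p := withSeminorms.continuous_seminorm ⟨p, hp⟩
  obtain ⟨C, hC⟩ := (isCompact_range (hpc.comp hG)).bddAbove
  exact ⟨C, fun n x => (le_ciSup (hbdd (G x)) n).trans (hC ⟨x, rfl⟩)⟩

/-- A compact family in `𝒪_C(ℝ²)` has uniform polynomial growth. -/
theorem exists_growth {X : Type*} [TopologicalSpace X] [CompactSpace X] {G : X → OC}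
    (hG : Continuous G) : ∃ (K : ℕ) (C : ℝ), ∀ x y, ‖G x y‖ ≤ C * (1 + ‖y‖ ^ 2) ^ K := by
  by_contra! H
  choose x y hxy using fun n : ℕ => H n n
  -- The weights `(1+|yₙ|²)⁻ⁿ` are eventually smaller than those of any given step.
  obtain ⟨C, hC⟩ := exists_bound_functionals hG
    (fun n => ((((1 + ‖y n‖ ^ 2) ^ n)⁻¹ : ℝ) : ℂ) • evalL (y n)) (by
      intro M
      refine ⟨M, 0, 1, fun n hn f B hB => ?_⟩
      have h0 := weightedBound_zero_iff.1 (hB 0 le_rfl) (y n)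
      have hB0 := WeightedBound.nonneg (hB 0 le_rfl)
      have hR : 0 < (1 + ‖y n‖ ^ 2) ^ n := by positivity
      rw [_root_.smul_apply, norm_smul, Complex.norm_real, Real.norm_of_nonneg
        (by positivity), evalL_apply, inv_mul_eq_div, div_le_iff₀ hR, one_mul]
      refine h0.trans (mul_le_mul_of_nonneg_left (pow_le_pow_right₀ ?_ hn) hB0)
      nlinarith [sq_nonneg ‖y n‖])
  obtain ⟨n, hn⟩ := exists_nat_gt C
  have h1 := hC n (x n)
  have hR : 0 < (1 + ‖y n‖ ^ 2) ^ n := by positivity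
  rw [_root_.smul_apply, norm_smul, Complex.norm_real, Real.norm_of_nonneg
    (by positivity), evalL_apply, inv_mul_eq_div, div_le_iff₀ hR] at h1
  have h2 := hxy n
  have h3 := mul_le_mul_of_nonneg_right hn.le hR.le
  linarith

theorem one_add_norm_sq_le {y : Plane} {i : Fin 2} {t N : ℝ} (ht : 0 ≤ t) (htN : t ≤ N) :
    1 + ‖y + t • stdVec i‖ ^ 2 ≤ (2 + 2 * N ^ 2) * (1 + ‖y‖ ^ 2) := by
  have h1 : ‖y + t • stdVec i‖ ≤ ‖y‖ + t := by
    refine (norm_add_le _ _).trans ?_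
    rw [norm_smul, Real.norm_of_nonneg ht]
    simp [stdVec]
  have h2 : ‖y + t • stdVec i‖ ^ 2 ≤ (‖y‖ + N) ^ 2 :=
    pow_le_pow_left₀ (norm_nonneg _) (h1.trans (by linarith)) 2
  nlinarith [sq_nonneg (‖y‖ - N), sq_nonneg ‖y‖, mul_nonneg (sq_nonneg ‖y‖) (sq_nonneg N)]

/-- If a compact family in `𝒪_C(ℝ²)` grows at most like `(1+|y|²)^K`, then all its pure partial
derivatives grow at most like `(1+|y|²)^(K+1)`: the exponent does not depend on the order. -/
theorem exists_growth_partialY_pow {X : Type*} [TopologicalSpace X] [CompactSpace X] {G : X → OC}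
    (hG : Continuous G) {K : ℕ} {C₀ : ℝ} (h0 : ∀ x y, ‖G x y‖ ≤ C₀ * (1 + ‖y‖ ^ 2) ^ K)
    (i : Fin 2) (j : ℕ) :
    ∃ C : ℝ, ∀ x y, ‖(partialY i ^ j) (G x) y‖ ≤ C * (1 + ‖y‖ ^ 2) ^ (K + 1) := by
  have hC₀' : ∀ x y, ‖G x y‖ ≤ |C₀| * (1 + ‖y‖ ^ 2) ^ K := fun x y =>
    (h0 x y).trans (mul_le_mul_of_nonneg_right (le_abs_self _) (by positivity))
  have hR1 : ∀ y : Plane, (1 : ℝ) ≤ 1 + ‖y‖ ^ 2 := fun y => by nlinarith [sq_nonneg ‖y‖]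
  rcases Nat.eq_zero_or_pos j with rfl | hj
  · refine ⟨|C₀|, fun x y => (hC₀' x y).trans ?_⟩
    exact mul_le_mul_of_nonneg_left (pow_le_pow_right₀ (hR1 y) (Nat.le_succ K)) (abs_nonneg _)
  by_contra! H
  choose c hc using fun n : ℕ => exists_finiteDiff_coeff j (n + j)
  -- `D n` compares `1 + |y|²` at the nodes and at the base point, `E n` bounds the constants in the
  -- errors of the `n`-th finite difference for all orders `m ≤ n + j` and all growth exponents
  -- `M ≤ n + j` at once, and `A n` is the constant for the finite difference on the family.
  set D : ℕ → ℝ := fun n => 2 + 2 * ((n + j : ℕ) : ℝ) ^ 2 with hD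
  have hD1 : ∀ n, 1 ≤ D n := fun n => by simp only [hD]; nlinarith [sq_nonneg ((n + j : ℕ) : ℝ)]
  set S : ℕ → ℝ := fun n => ∑ l ∈ Finset.range (n + j + 1), |c n l| with hS
  have hS0 : ∀ n, 0 ≤ S n := fun n => Finset.sum_nonneg fun _ _ => abs_nonneg _
  set E : ℕ → ℝ := fun n =>
    1 + j.factorial * (S n * (((n + j : ℕ) : ℝ) ^ (n + j)) * D n ^ (n + j)) with hE
  have hE0 : ∀ n, 0 < E n := fun n => by
    have := hS0 n
    have := hD1 n
    simp only [hE]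
    positivity
  set A : ℕ → ℝ := fun n => j.factorial * (S n * (|C₀| * D n ^ K)) with hA
  choose x y hxy using fun n : ℕ => H (A n + n * E n)
  set R : ℕ → ℝ := fun n => 1 + ‖y n‖ ^ 2 with hR
  have hRpos : ∀ n, 0 < R n := fun n => zero_lt_one.trans_le (hR1 (y n))
  set r : ℕ → ℝ := fun n => (R n)⁻¹ ^ ((j : ℝ)⁻¹) with hr
  have hr0 : ∀ n, 0 ≤ r n := fun n => Real.rpow_nonneg (inv_nonneg.2 (hRpos n).le) _
  have hr1 : ∀ n, r n ≤ 1 := fun n =>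
    Real.rpow_le_one (inv_nonneg.2 (hRpos n).le) (inv_le_one_of_one_le₀ (hR1 (y n))) (by positivity)
  have hrj : ∀ n, r n ^ j = (R n)⁻¹ := fun n =>
    Real.rpow_inv_natCast_pow (inv_nonneg.2 (hRpos n).le) hj.ne'
  set F : ℕ → OC →L[ℂ] ℂ := fun n => (evalL (y n)).comp (partialY i ^ j) -
    ((j.factorial * R n : ℝ) : ℂ) •
      ∑ l ∈ Finset.range (n + j + 1), (c n l : ℂ) • evalL (y n + (l * r n) • stdVec i) with hF
  have hFapp : ∀ n f, F n f = (partialY i ^ j) f (y n) - ((j.factorial * R n : ℝ) : ℂ) *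
      ∑ l ∈ Finset.range (n + j + 1), (c n l : ℂ) * f (y n + (l * r n) • stdVec i) := by
    intro n f
    simp [hF, evalL_apply]
  have hpt : ∀ n t, t ∈ Set.Icc 0 (((n + j : ℕ) : ℝ) * r n) →
      1 + ‖y n + t • stdVec i‖ ^ 2 ≤ D n * R n := fun n t ht =>
    one_add_norm_sq_le ht.1 (ht.2.trans (mul_le_of_le_one_right (by positivity) (hr1 n)))
  have hnode : ∀ n l, l ∈ Finset.range (n + j + 1) →
      (l * r n : ℝ) ∈ Set.Icc 0 (((n + j : ℕ) : ℝ) * r n) := by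
    intro n l hl
    have hl' : (l : ℝ) ≤ ((n + j : ℕ) : ℝ) := by
      exact_mod_cast Nat.lt_succ_iff.1 (Finset.mem_range.1 hl)
    exact ⟨mul_nonneg (Nat.cast_nonneg _) (hr0 n), mul_le_mul_of_nonneg_right hl' (hr0 n)⟩
  -- On functions of growth `(1+|y|²)^M` the error is of size `R^(1+M) r^m`, which is at most `1` for
  -- `m = j (M + 2)` because `r^j = R⁻¹`.
  have herr : ∀ (M n : ℕ), j * (M + 2) ≤ n → ∀ (f : OC) (B : ℝ),
      (∀ l ≤ j * (M + 2), WeightedBound (-M) l f.val B) → ‖F n f‖ ≤ E n * B := by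
    intro M n hn f B hB
    have hB0 : 0 ≤ B := WeightedBound.nonneg (hB 0 (Nat.zero_le _))
    set m := j * (M + 2) with hm
    have hjm : j < m := by rw [hm]; nlinarith
    have hMm : M ≤ m := by rw [hm]; nlinarith
    have hfd := norm_finiteDiff_sub_le (hc n) (m := m) (by omega) hjm
      (g := fun l t => (partialY i ^ l) f (y n + t • stdVec i))
      (fun l t => by
        have := hasDerivAt_line ((partialY i ^ l) f) i (y n) t
        rwa [← mul_apply_eq_comp, ← pow_succ'] at this)
      (hr0 n) (B := B * (D n * R n) ^ M) (fun t ht => by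
        have h1 := weightedBound_zero_iff.1
          (weightedBound_partialY_pow i m 0 f (by rw [zero_add]; exact hB m le_rfl))
          (y n + t • stdVec i)
        refine h1.trans (mul_le_mul_of_nonneg_left (pow_le_pow_left₀ (by positivity) ?_ M) hB0)
        exact hpt n t ht)
    have hsum : ∑ l ∈ Finset.range (n + j + 1), |c n l| * (l : ℝ) ^ m ≤
        S n * ((n + j : ℕ) : ℝ) ^ (n + j) := by
      rw [hS, Finset.sum_mul]
      refine Finset.sum_le_sum fun l hl => mul_le_mul_of_nonneg_left ?_ (abs_nonneg _)
      have hl' : (l : ℝ) ≤ ((n + j : ℕ) : ℝ) := by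
        exact_mod_cast Nat.lt_succ_iff.1 (Finset.mem_range.1 hl)
      have h1N : (1 : ℝ) ≤ ((n + j : ℕ) : ℝ) := by exact_mod_cast (by omega : 1 ≤ n + j)
      exact (pow_le_pow_left₀ (Nat.cast_nonneg _) hl' m).trans (pow_le_pow_right₀ h1N (by omega))
    have hrm : r n ^ m = (R n)⁻¹ ^ (M + 2) := by rw [hm, pow_mul, hrj]
    have heq : F n f = -((j.factorial * R n : ℝ) : ℂ) *
        (∑ l ∈ Finset.range (n + j + 1), (c n l : ℂ) * f (y n + (l * r n) • stdVec i) -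
          ((r n ^ j / j.factorial : ℝ) : ℂ) * (partialY i ^ j) f (y n)) := by
      rw [hFapp, hrj]
      have h1 : ((j.factorial * R n : ℝ) : ℂ) * (((R n)⁻¹ / j.factorial : ℝ) : ℂ) = 1 := by
        rw [← Complex.ofReal_mul, ← Complex.ofReal_one]
        congr 1
        have := (hRpos n).ne'
        field_simp
      linear_combination (-(partialY i ^ j) f (y n)) * h1
    simp only [pow_zero, zero_smul, add_zero, one_apply_eq_self] at hfd
    rw [heq, norm_mul, norm_neg, Complex.norm_real, Real.norm_of_nonneg
      (mul_nonneg (Nat.cast_nonneg _) (hRpos n).le)]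
    have hDR : R n * (R n ^ M * (R n)⁻¹ ^ (M + 2)) ≤ 1 := by
      have : R n * (R n ^ M * (R n)⁻¹ ^ (M + 2)) = (R n)⁻¹ := by
        have := (hRpos n).ne'
        rw [inv_pow]
        field_simp
        ring
      rw [this]
      exact inv_le_one_of_one_le₀ (hR1 (y n))
    have hDM : D n ^ M ≤ D n ^ (n + j) := pow_le_pow_right₀ (hD1 n) (by omega)
    have hX : 0 ≤ S n * ((n + j : ℕ) : ℝ) ^ (n + j) := mul_nonneg (hS0 n) (by positivity)
    have hDn0 : 0 ≤ D n := zero_le_one.trans (hD1 n)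
    have hRn0 := (hRpos n).le
    have hinv : 0 ≤ (R n)⁻¹ := inv_nonneg.2 hRn0
    calc j.factorial * R n * _
        ≤ j.factorial * R n * (B * (D n * R n) ^ M * r n ^ m *
            (S n * ((n + j : ℕ) : ℝ) ^ (n + j))) := by
          refine mul_le_mul_of_nonneg_left (hfd.trans ?_) (by positivity)
          refine mul_le_mul_of_nonneg_left hsum ?_
          have := hr0 n
          positivity
      _ = (j.factorial * (S n * ((n + j : ℕ) : ℝ) ^ (n + j) * D n ^ M)) * B *
            (R n * (R n ^ M * (R n)⁻¹ ^ (M + 2))) := by rw [hrm, mul_pow]; ring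
      _ ≤ (j.factorial * (S n * ((n + j : ℕ) : ℝ) ^ (n + j) * D n ^ M)) * B * 1 :=
          mul_le_mul_of_nonneg_left hDR (by positivity)
      _ ≤ (j.factorial * (S n * ((n + j : ℕ) : ℝ) ^ (n + j) * D n ^ (n + j))) * B * 1 := by
          gcongr
      _ ≤ E n * B := by
          rw [mul_one]
          exact mul_le_mul_of_nonneg_right (by simp only [hE]; linarith) hB0
  obtain ⟨C, hC⟩ := exists_bound_functionals hG
    (fun n => (((E n * R n ^ (K + 1))⁻¹ : ℝ) : ℂ) • F n) (by
      intro M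
      refine ⟨j * (M + 2), j * (M + 2), 1, fun n hn f B hB => ?_⟩
      have hB0 : 0 ≤ B := WeightedBound.nonneg (hB 0 (Nat.zero_le _))
      have hpos : 0 < E n * R n ^ (K + 1) := mul_pos (hE0 n) (pow_pos (hRpos n) _)
      rw [_root_.smul_apply, norm_smul, Complex.norm_real, Real.norm_of_nonneg
        (inv_nonneg.2 hpos.le), inv_mul_eq_div, div_le_iff₀ hpos]
      refine (herr M n hn f B hB).trans ?_
      have h1 : 1 ≤ R n ^ (K + 1) := one_le_pow₀ (hR1 (y n))
      have h2 : 0 ≤ E n * B := mul_nonneg (hE0 n).le hB0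
      nlinarith)
  obtain ⟨n, hn⟩ := exists_nat_gt C
  have h1 := hC n (x n)
  have hpos : 0 < E n * R n ^ (K + 1) := mul_pos (hE0 n) (pow_pos (hRpos n) _)
  rw [_root_.smul_apply, norm_smul, Complex.norm_real, Real.norm_of_nonneg
    (inv_nonneg.2 hpos.le), inv_mul_eq_div, div_le_iff₀ hpos, hFapp] at h1
  -- On the given family the finite difference itself is at most `r^(-j) R^K = R^(K+1)` in size, so
  -- that the large derivative shows up in the error.
  have h2 : ‖((j.factorial * R n : ℝ) : ℂ) * ∑ l ∈ Finset.range (n + j + 1),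
      (c n l : ℂ) * (G (x n)) (y n + (l * r n) • stdVec i)‖ ≤ A n * R n ^ (K + 1) := by
    rw [norm_mul, Complex.norm_real, Real.norm_of_nonneg
      (mul_nonneg (Nat.cast_nonneg _) (hRpos n).le)]
    have h3 : ‖∑ l ∈ Finset.range (n + j + 1),
        (c n l : ℂ) * (G (x n)) (y n + (l * r n) • stdVec i)‖ ≤
        S n * (|C₀| * (D n * R n) ^ K) := by
      rw [hS, Finset.sum_mul]
      refine norm_sum_le_of_le _ fun l hl => ?_
      rw [norm_mul, Complex.norm_real, Real.norm_eq_abs]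
      refine mul_le_mul_of_nonneg_left ((hC₀' _ _).trans ?_) (abs_nonneg _)
      refine mul_le_mul_of_nonneg_left (pow_le_pow_left₀ (by positivity) ?_ K) (abs_nonneg _)
      exact hpt n _ (hnode n l hl)
    refine (mul_le_mul_of_nonneg_left h3 (mul_nonneg (Nat.cast_nonneg _) (hRpos n).le)).trans_eq ?_
    simp only [hA]
    rw [mul_pow]
    ring
  have h4 := hxy n
  have h5 := norm_sub_norm_le ((partialY i ^ j) (G (x n)) (y n)) (((j.factorial * R n : ℝ) : ℂ) *
    ∑ l ∈ Finset.range (n + j + 1), (c n l : ℂ) * (G (x n)) (y n + (l * r n) • stdVec i))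
  have h6 := mul_le_mul_of_nonneg_right hn.le hpos.le
  have h7 : (A n + n * E n) * R n ^ (K + 1) =
    A n * R n ^ (K + 1) + n * (E n * R n ^ (K + 1)) := by ring
  change (A n + n * E n) * R n ^ (K + 1) < _ at h4
  linarith

/-- The inductive limit `𝒪_C(ℝ²)` is regular: a compact family lies, and is bounded, in one of the
steps. -/
theorem exists_uniform_growth {X : Type*} [TopologicalSpace X] [CompactSpace X] {G : X → OC}
    (hG : Continuous G) : ∃ K : ℕ, ∀ b, ∃ C : ℝ, 0 ≤ C ∧
      ∀ x y, ‖dy b (G x) y‖ ≤ C * (1 + ‖y‖ ^ 2) ^ K := by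
  obtain ⟨K, C₀, h0⟩ := exists_growth hG
  refine ⟨K + 2, fun b => ?_⟩
  obtain ⟨C₁, h1⟩ := exists_growth_partialY_pow hG h0 1 (b 1)
  obtain ⟨C₂, h2⟩ := exists_growth_partialY_pow ((partialY 1 ^ b 1).continuous.comp hG) h1 0 (b 0)
  exact ⟨|C₂|, abs_nonneg _, fun x y => (h2 x y).trans
    (mul_le_mul_of_nonneg_right (le_abs_self _) (by positivity))⟩

end OC

namespace OC

/-- The functions of a partial family are the derivatives `∂^b` of its first member. -/
theorem dy_apply_eq {g : (Fin 2 → ℕ) → Plane → ℂ} (hg : PartialFamily g) {f : OC}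
    (hf : f.val = g 0) (b : Fin 2 → ℕ) : (dy b f).val = g b := by
  induction b using multiIndex_induction with
  | h0 => exact hf
  | hs b i ih =>
    funext y
    have h := f.partialFamily_dy.hasDerivAt b i y
    simp only [ih] at h
    exact h.unique (hg.hasDerivAt b i y)

/-- The supremum over a ball, as a seminorm. -/
def ballSeminorm (ρ : ℝ) : Seminorm ℂ OC :=
  have hbdd : ∀ f : OC, BddAbove (Set.range fun y : Metric.closedBall (0 : Plane) ρ => ‖f y‖) :=
    fun f => by
      have := (isCompact_closedBall (0 : Plane) ρ).bddAbove_image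
        (f := fun y => ‖f y‖) f.contDiff.continuous.norm.continuousOn
      rwa [Set.image_eq_range] at this
  Seminorm.of (fun f => ⨆ y : Metric.closedBall (0 : Plane) ρ, ‖f y‖)
    (fun f g => Real.iSup_le (fun y => (norm_add_le _ _).trans
      (add_le_add (le_ciSup (hbdd f) y) (le_ciSup (hbdd g) y)))
      (add_nonneg (Real.iSup_nonneg fun _ => norm_nonneg _)
        (Real.iSup_nonneg fun _ => norm_nonneg _)))
    (fun c f => by
      simp only [smul_apply, norm_mul]
      exact (Real.mul_iSup_of_nonneg (norm_nonneg c) _).symm)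

theorem norm_le_ballSeminorm {ρ : ℝ} (f : OC) {y : Plane} (hy : ‖y‖ ≤ ρ) :
    ‖f y‖ ≤ ballSeminorm ρ f := by
  have h := (isCompact_closedBall (0 : Plane) ρ).bddAbove_image
    (f := fun y => ‖f y‖) f.contDiff.continuous.norm.continuousOn
  rw [Set.image_eq_range] at h
  exact le_ciSup h ⟨y, by simpa using hy⟩

theorem isStepwiseContinuous_ballSeminorm (ρ : ℝ) : IsStepwiseContinuous (ballSeminorm ρ) := by
  intro k
  refine ⟨0, (1 + ρ ^ 2) ^ k.natAbs, fun f _ B hB => ?_⟩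
  have hB0 : 0 ≤ B := WeightedBound.nonneg (hB 0 le_rfl)
  have h := weightedBound_zero_iff.1 ((hB 0 le_rfl).mono (k := -(k.natAbs : ℤ)) (by omega))
  refine Real.iSup_le (fun y => (h y).trans ?_) (by positivity)
  have hy : ‖(y : Plane)‖ ≤ ρ := mem_closedBall_zero_iff.1 y.2
  rw [mul_comm]
  gcongr

/-- The evaluation map is jointly continuous on `𝒪_C(ℝ²) × ℝ²`. -/
theorem continuous_eval : Continuous fun q : OC × Plane => q.1 q.2 := by
  refine continuous_iff_continuousAt.2 fun ⟨f, y⟩ => ?_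
  have hp : Continuous (ballSeminorm (‖y‖ + 1)) :=
    withSeminorms.continuous_seminorm ⟨_, isStepwiseContinuous_ballSeminorm _⟩
  have h1 : Tendsto (fun q : OC × Plane => ballSeminorm (‖y‖ + 1) (q.1 - f)) (𝓝 (f, y)) (𝓝 0) := by
    have : Continuous fun q : OC × Plane => ballSeminorm (‖y‖ + 1) (q.1 - f) :=
      hp.comp (continuous_fst.sub continuous_const)
    simpa using this.tendsto (f, y)
  have h2 : Tendsto (fun q : OC × Plane => f q.2) (𝓝 (f, y)) (𝓝 (f y)) :=
    (f.contDiff.continuous.comp continuous_snd).tendsto (f, y)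
  have h3 : Tendsto (fun q : OC × Plane => q.1 q.2 - f q.2) (𝓝 (f, y)) (𝓝 0) := by
    refine squeeze_zero_norm' ?_ h1
    have hev : ∀ᶠ q : OC × Plane in 𝓝 (f, y), ‖q.2‖ < ‖y‖ + 1 :=
      (continuous_snd.norm.tendsto (f, y)).eventually (gt_mem_nhds (lt_add_one ‖y‖))
    filter_upwards [hev] with q hq
    exact norm_le_ballSeminorm (q.1 - f) hq.le
  have h4 := h3.add h2
  simp only [sub_add_cancel, zero_add] at h4
  exact h4

end OC

/-! ### The torus as a quotient of the plane -/

theorem torusMk_add (v w : Plane) : torusMk (v + w) = torusMk v + torusMk w := rfl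

theorem torusMk_zero : torusMk 0 = 0 := rfl

theorem isOpenQuotientMap_torusMk : IsOpenQuotientMap torusMk := by
  have h1 : IsOpenQuotientMap fun (v : Fin 2 → ℝ) (i : Fin 2) => (v i : UnitAddCircle) :=
    ⟨fun x => ⟨fun i => (QuotientAddGroup.mk_surjective (x i)).choose,
        funext fun i => (QuotientAddGroup.mk_surjective (x i)).choose_spec⟩,
      continuous_pi fun i => continuous_quotient_mk'.comp (continuous_apply i),
      IsOpenMap.piMap (fun i => QuotientAddGroup.isOpenMap_coe)
        (Eventually.of_forall fun i => QuotientAddGroup.mk_surjective)⟩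
  exact h1.comp (EuclideanSpace.equiv (Fin 2) ℝ).toHomeomorph.isOpenQuotientMap

theorem continuous_torusMk : Continuous torusMk := isOpenQuotientMap_torusMk.continuous

/-! ### Tempered families -/

/-- A function `φ 0 0` on `𝕋² × ℝ²` given together with all its partial derivatives
`φ a b = ∂_x^a ∂_y^b (φ 0 0)`, which are continuous and of polynomial growth. The exponent of
growth may depend on `a`, but not on `b`: this characterizes the smooth sections of `𝒲`. -/
structure TemperedFamily (φ : (Fin 2 → ℕ) → (Fin 2 → ℕ) → Torus2 → Plane → ℂ) : Prop where
  continuous : ∀ a b, Continuous fun q : Torus2 × Plane => φ a b q.1 q.2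
  hasDerivAt_x : ∀ a b i x y, HasDerivAt (fun t : ℝ => φ a b (x + torusMk (t • stdVec i)) y)
    (φ (a + Pi.single i 1) b x y) 0
  hasDerivAt_y : ∀ a b i x y, HasDerivAt (fun t : ℝ => φ a b x (y + t • stdVec i))
    (φ a (b + Pi.single i 1) x y) 0
  growth : ∀ a, ∃ K : ℕ, ∀ b, ∃ C : ℝ, 0 ≤ C ∧ ∀ x y, ‖φ a b x y‖ ≤ C * (1 + ‖y‖ ^ 2) ^ K

theorem hasDerivAt_iff_tendsto_smul {h : ℝ → ℂ} {h' : ℂ} :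
    HasDerivAt h h' 0 ↔ Tendsto (fun t : ℝ => (t : ℂ)⁻¹ • (h t - h 0)) (𝓝[≠] 0) (𝓝 h') := by
  rw [hasDerivAt_iff_tendsto_slope_zero]
  refine tendsto_congr fun t => ?_
  rw [zero_add, ← Complex.ofReal_inv, Complex.coe_smul]

theorem HasTorusPartial.hasDerivAt {i : Fin 2} {F F' : Torus2 → ℂ} (h : HasTorusPartial i F F')
    (x : Torus2) : HasDerivAt (fun t : ℝ => F (x + torusMk (t • stdVec i))) (F' x) 0 := by
  rw [hasDerivAt_iff_tendsto_smul]
  simpa [torusMk_zero] using h x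

theorem HasTorusPartial.clm_comp {i : Fin 2} {F F' : Torus2 → OC} (h : HasTorusPartial i F F')
    (L : OC →L[ℂ] ℂ) : HasTorusPartial i (fun x => L (F x)) (fun x => L (F' x)) := by
  intro x
  refine ((L.continuous.tendsto _).comp (h x)).congr fun t => ?_
  simp

/-- A smooth section of `𝒲` and all its derivatives form a tempered family. The uniformity of the
growth is the regularity of the inductive limit `𝒪_C(ℝ²)`. -/
theorem exists_temperedFamily (F : Sections) :
    ∃ φ, TemperedFamily φ ∧ ∀ x y, φ 0 0 x y = F.val x y := by
  obtain ⟨F, D, rfl, hD⟩ := F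
  refine ⟨fun a b x y => OC.dy b (D a x) y, ⟨fun a b => ?_, fun a b i x y => ?_,
    fun a b i x y => ?_, fun a => OC.exists_uniform_growth (hD a).1⟩, fun x y => rfl⟩
  · exact OC.continuous_eval.comp
      ((((OC.dy b).continuous.comp (hD a).1).comp continuous_fst).prodMk continuous_snd)
  · exact (((hD a).2 i).clm_comp ((OC.evalL y).comp (OC.dy b))).hasDerivAt x
  · exact (D a x).partialFamily_dy.hasDerivAt b i y

theorem norm_line_sub_le {h h' : ℝ → ℂ} (hh : ∀ t, HasDerivAt h (h' t) t) {C : ℝ}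
    (hC : ∀ t, ‖h' t‖ ≤ C) (t : ℝ) : ‖h t - h 0‖ ≤ C * |t| := by
  have := convex_univ.norm_image_sub_le_of_norm_hasDerivWithin_le (f := h) (f' := h') (C := C)
    (fun x _ => (hh x).hasDerivWithinAt) (fun x _ => hC x) (Set.mem_univ (0 : ℝ)) (Set.mem_univ t)
  simpa using this

theorem norm_line_sub_linear_le {h h' h'' : ℝ → ℂ} (hh : ∀ t, HasDerivAt h (h' t) t)
    (hh' : ∀ t, HasDerivAt h' (h'' t) t) {C : ℝ} (hC : ∀ t, ‖h'' t‖ ≤ C) (t : ℝ) :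
    ‖h t - h 0 - t * h' 0‖ ≤ C * |t| * |t| := by
  have hC0 : 0 ≤ C := (norm_nonneg _).trans (hC 0)
  have hd : ∀ s, HasDerivAt (fun s : ℝ => h s - s * h' 0) (h' s - h' 0) s := fun s => by
    simpa using (hh s).fun_sub (((hasDerivAt_id s).ofReal_comp).mul_const (h' 0))
  have := (convex_uIcc (0 : ℝ) t).norm_image_sub_le_of_norm_hasDerivWithin_le
    (f := fun s : ℝ => h s - s * h' 0) (f' := fun s => h' s - h' 0) (C := C * |t|)
    (fun x _ => (hd x).hasDerivWithinAt)
    (fun s hs => (norm_line_sub_le hh' hC s).trans (by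
      refine mul_le_mul_of_nonneg_left ?_ hC0
      simpa only [sub_zero] using Set.abs_sub_left_of_mem_uIcc hs)) Set.left_mem_uIcc Set.right_mem_uIcc
  simpa [sub_right_comm] using this

namespace TemperedFamily

variable {φ : (Fin 2 → ℕ) → (Fin 2 → ℕ) → Torus2 → Plane → ℂ}

theorem partialFamily (hφ : TemperedFamily φ) (a : Fin 2 → ℕ) (x : Torus2) :
    PartialFamily fun b => φ a b x where
  continuous b := (hφ.continuous a b).comp (by fun_prop : Continuous fun y => (x, y))
  hasDerivAt b i y := hφ.hasDerivAt_y a b i x y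

theorem hasDerivAt_x_line (hφ : TemperedFamily φ) (a b : Fin 2 → ℕ) (i : Fin 2) (x : Torus2)
    (y : Plane) (t : ℝ) : HasDerivAt (fun t : ℝ => φ a b (x + torusMk (t • stdVec i)) y)
    (φ (a + Pi.single i 1) b (x + torusMk (t • stdVec i)) y) t := by
  have h := hφ.hasDerivAt_x a b i (x + torusMk (t • stdVec i)) y
  rw [← sub_self t] at h
  have h2 := h.comp_sub_const t t
  refine h2.congr_of_eventuallyEq (Eventually.of_forall fun s => ?_)
  simp only [add_assoc, ← torusMk_add, ← add_smul]
  congr 4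
  ring

/-- Two multi-indices `a` have a common exponent of growth. -/
theorem growth_max (hφ : TemperedFamily φ) (a₁ a₂ : Fin 2 → ℕ) : ∃ K : ℕ, ∀ b, ∃ C : ℝ, 0 ≤ C ∧
    ∀ x y, ‖φ a₁ b x y‖ ≤ C * (1 + ‖y‖ ^ 2) ^ K ∧ ‖φ a₂ b x y‖ ≤ C * (1 + ‖y‖ ^ 2) ^ K := by
  obtain ⟨K₁, h₁⟩ := hφ.growth a₁
  obtain ⟨K₂, h₂⟩ := hφ.growth a₂
  refine ⟨max K₁ K₂, fun b => ?_⟩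
  obtain ⟨C₁, hC₁, h₁⟩ := h₁ b
  obtain ⟨C₂, hC₂, h₂⟩ := h₂ b
  have hR : ∀ y : Plane, (1 : ℝ) ≤ 1 + ‖y‖ ^ 2 := fun y => by nlinarith [sq_nonneg ‖y‖]
  refine ⟨max C₁ C₂, hC₁.trans (le_max_left _ _), fun x y => ⟨(h₁ x y).trans ?_, (h₂ x y).trans ?_⟩⟩
  · exact mul_le_mul (le_max_left _ _) (pow_le_pow_right₀ (hR y) (le_max_left _ _))
      (by positivity) (hC₁.trans (le_max_left _ _))
  · exact mul_le_mul (le_max_right _ _) (pow_le_pow_right₀ (hR y) (le_max_right _ _))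
      (by positivity) (hC₁.trans (le_max_left _ _))

/-- The derivative `∂_x^a` of a tempered family, as a map into `𝒪_C(ℝ²)`. -/
def toOC (hφ : TemperedFamily φ) (a : Fin 2 → ℕ) (x : Torus2) : OC :=
  OC.mk (φ a 0 x) ⟨-((hφ.growth a).choose : ℕ), (hφ.partialFamily a x).inStep fun b =>
    ((hφ.growth a).choose_spec b).imp fun _ h => h.2 x⟩

theorem dy_toOC (hφ : TemperedFamily φ) (a b : Fin 2 → ℕ) (x : Torus2) (y : Plane) :
    OC.dy b (hφ.toOC a x) y = φ a b x y :=
  congrFun (OC.dy_apply_eq (hφ.partialFamily a x) rfl b) y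

theorem inStep_of_dy {f : OC} {K : ℕ} (h : ∀ b, ∃ C : ℝ, ∀ y, ‖OC.dy b f y‖ ≤
    C * (1 + ‖y‖ ^ 2) ^ K) : InStep (-K) f.val := f.partialFamily_dy.inStep h

theorem continuous_toOC (hφ : TemperedFamily φ) (a : Fin 2 → ℕ) : Continuous (hφ.toOC a) := by
  rw [isOpenQuotientMap_torusMk.isQuotientMap.continuous_iff]
  refine continuous_iff_continuousAt.2 fun v => ?_
  obtain ⟨K, hK⟩ := hφ.growth_max (a + Pi.single 0 1) (a + Pi.single 1 1)
  choose C hC0 hC using hK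
  have hbd : ∀ b w y, ‖OC.dy b (hφ.toOC a (torusMk w) - hφ.toOC a (torusMk v)) y‖ ≤
      (C b * (|w 0 - v 0| + |w 1 - v 1|)) * (1 + ‖y‖ ^ 2) ^ K := by
    intro b w y
    rw [map_sub, OC.sub_apply, dy_toOC, dy_toOC]
    have h0 := norm_line_sub_le (hφ.hasDerivAt_x_line a b 0 (torusMk v) y)
      (fun t => (hC b _ y).1) (w 0 - v 0)
    have h1 := norm_line_sub_le
      (hφ.hasDerivAt_x_line a b 1 (torusMk v + torusMk ((w 0 - v 0) • stdVec 0)) y)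
      (fun t => (hC b _ y).2) (w 1 - v 1)
    have hw : torusMk v + torusMk ((w 0 - v 0) • stdVec 0) + torusMk ((w 1 - v 1) • stdVec 1) =
        torusMk w := by
      rw [add_assoc, ← torusMk_add, ← torusMk_add]
      congr 1
      have := eq_sum_stdVec (w - v)
      simp only [PiLp.sub_apply] at this
      rw [← this]
      abel
    rw [hw] at h1
    simp only [zero_smul, torusMk_zero, add_zero] at h0 h1
    have := norm_add_le
      (φ a b (torusMk w) y - φ a b (torusMk v + torusMk ((w 0 - v 0) • stdVec 0)) y)
      (φ a b (torusMk v + torusMk ((w 0 - v 0) • stdVec 0)) y - φ a b (torusMk v) y)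
    rw [sub_add_sub_cancel] at this
    refine this.trans ((add_le_add h1 h0).trans_eq ?_)
    ring
  have ht : Tendsto (fun w => hφ.toOC a (torusMk w) - hφ.toOC a (torusMk v)) (𝓝 v) (𝓝 0) := by
    refine OC.tendsto_zero_of_dy K (fun b => ⟨fun w => C b * (|w 0 - v 0| + |w 1 - v 1|), ?_,
      Eventually.of_forall fun w => hbd b w⟩) fun w => inStep_of_dy fun b => ⟨_, hbd b w⟩
    have : Continuous fun w : Plane => C b * (|w 0 - v 0| + |w 1 - v 1|) := by fun_prop
    simpa using this.tendsto v
  have h := ht.add_const (hφ.toOC a (torusMk v))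
  rw [zero_add] at h
  exact h.congr fun w => sub_add_cancel _ _

theorem hasTorusPartial_toOC (hφ : TemperedFamily φ) (a : Fin 2 → ℕ) (i : Fin 2) :
    HasTorusPartial i (hφ.toOC a) (hφ.toOC (a + Pi.single i 1)) := by
  intro x
  obtain ⟨K, hK⟩ := hφ.growth (a + Pi.single i 1 + Pi.single i 1)
  choose C hC0 hC using hK
  -- The difference quotient minus the derivative, which is of size `|t|` by Taylor's formula.
  set g : ℝ → OC := fun t => (t : ℂ)⁻¹ • (hφ.toOC a (x + torusMk (t • stdVec i)) - hφ.toOC a x) -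
    hφ.toOC (a + Pi.single i 1) x with hg
  obtain ⟨K', hK'⟩ := hφ.growth_max a (a + Pi.single i 1)
  choose C' hC0' hC' using hK'
  have hbd : ∀ b t, t ≠ 0 → ∀ y, ‖OC.dy b (g t) y‖ ≤ (C b * |t|) * (1 + ‖y‖ ^ 2) ^ K := by
    intro b t ht y
    simp only [hg, map_sub, map_smul, OC.sub_apply, OC.smul_apply, dy_toOC]
    have h := norm_line_sub_linear_le (hφ.hasDerivAt_x_line a b i x y)
      (hφ.hasDerivAt_x_line (a + Pi.single i 1) b i x y) (fun t => hC b _ y) t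
    simp only [zero_smul, torusMk_zero, add_zero] at h
    have htc : (t : ℂ) ≠ 0 := by exact_mod_cast ht
    have he : (t : ℂ)⁻¹ * (φ a b (x + torusMk (t • stdVec i)) y - φ a b x y) -
        φ (a + Pi.single i 1) b x y = (t : ℂ)⁻¹ * (φ a b (x + torusMk (t • stdVec i)) y -
          φ a b x y - t * φ (a + Pi.single i 1) b x y) := by
      field_simp
    rw [he, norm_mul, norm_inv, Complex.norm_real, Real.norm_eq_abs, inv_mul_eq_div,
      div_le_iff₀ (abs_pos.2 ht)]
    refine h.trans_eq ?_
    ring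
  have hR : ∀ y : Plane, (1 : ℝ) ≤ 1 + ‖y‖ ^ 2 := fun y => by nlinarith [sq_nonneg ‖y‖]
  have ht : Tendsto g (𝓝[≠] 0) (𝓝 0) := by
    refine OC.tendsto_zero_of_dy (max K K') (fun b => ⟨fun t => C b * |t|, ?_, ?_⟩) fun t => ?_
    · have : Continuous fun t : ℝ => C b * |t| := by fun_prop
      simpa using (this.tendsto 0).mono_left nhdsWithin_le_nhds
    · filter_upwards [self_mem_nhdsWithin] with t ht y
      refine (hbd b t ht y).trans ?_
      gcongr
      · exact mul_nonneg (hC0 b) (abs_nonneg t)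
      · exact hR y
      · exact le_max_left _ _
    · refine inStep_of_dy fun b => ?_
      rcases eq_or_ne t 0 with rfl | ht
      · refine ⟨C' b, fun y => ?_⟩
        simp only [hg, Complex.ofReal_zero, inv_zero, zero_smul, zero_sub, map_neg]
        change ‖-(OC.dy b (hφ.toOC (a + Pi.single i 1) x) y)‖ ≤ _
        rw [norm_neg, dy_toOC]
        refine (hC' b x y).2.trans ?_
        gcongr
        · exact hC0' b
        · exact hR y
        · exact le_max_right _ _
      · refine ⟨C b * |t|, fun y => (hbd b t ht y).trans ?_⟩
        gcongr
        · exact mul_nonneg (hC0 b) (abs_nonneg t)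
        · exact hR y
        · exact le_max_left _ _
  have h := ht.add_const (hφ.toOC (a + Pi.single i 1) x)
  rw [zero_add] at h
  exact h.congr fun t => sub_add_cancel _ _

/-- A tempered family is a smooth section of `𝒲`. -/
def toSection (hφ : TemperedFamily φ) : Sections :=
  ⟨hφ.toOC 0, hφ.toOC, rfl, fun a => ⟨hφ.continuous_toOC a, hφ.hasTorusPartial_toOC a⟩⟩

theorem toSection_val (hφ : TemperedFamily φ) (x : Torus2) (y : Plane) :
    hφ.toSection.val x y = φ 0 0 x y := rfl

end TemperedFamily

theorem Sections.ext {F G : Sections} (h : ∀ x y, F.val x y = G.val x y) : F = G :=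
  Subtype.ext (funext fun x => OC.ext (h x))

/-- The operator `∂/∂xⁱ - ∂/∂yⁱ` in terms of tempered families. -/
theorem TemperedFamily.secD_val {φ : (Fin 2 → ℕ) → (Fin 2 → ℕ) → Torus2 → Plane → ℂ}
    (hφ : TemperedFamily φ) {F : Sections} (hF : ∀ x y, φ 0 0 x y = F.val x y) (i : Fin 2)
    (x : Torus2) (y : Plane) :
    (secD i F).val x y = φ (Pi.single i 1) 0 x y - φ 0 (Pi.single i 1) x y := by
  have h1 : (torusPartial i (F : smoothTorus OC)).1 x y = φ (Pi.single i 1) 0 x y := by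
    have h := ((torusPartial_spec i (F : smoothTorus OC)).clm_comp (OC.evalL y)).hasDerivAt x
    have h2 := hφ.hasDerivAt_x 0 0 i x y
    simp only [zero_add, hF] at h2
    exact h.unique h2
  have h2 : OC.partialY i (F.val x) y = φ 0 (Pi.single i 1) x y := by
    have h := (F.val x).hasDerivAt_line i y 0
    have h2 := hφ.hasDerivAt_y 0 0 i x y
    simp only [zero_add, hF] at h2
    simpa using h.unique h2
  rw [← h1, ← h2]
  rfl

/-! ### Multiplication by a cutoff function -/

namespace OC

theorem weightedBound_mul {k : ℤ} {χ f : Plane → ℂ} (hχ : ContDiff ℝ ∞ χ) (hf : ContDiff ℝ ∞ f)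
    {A : ℕ → ℝ} (hA : ∀ j, WeightedBound 0 j χ (A j)) {j : ℕ} {B : ℝ}
    (hB : ∀ l ≤ j, WeightedBound k l f B) :
    WeightedBound k j (fun y => χ y * f y)
      ((∑ l ∈ Finset.range (j + 1), (j.choose l : ℝ) * A l) * B) := by
  intro y
  have hw : (0 : ℝ) ≤ (1 + ‖y‖ ^ 2) ^ k := by positivity
  refine (mul_le_mul_of_nonneg_left (norm_iteratedFDeriv_mul_le hχ hf y
    (mod_cast le_top)) hw).trans ?_
  rw [Finset.mul_sum, Finset.sum_mul]
  refine Finset.sum_le_sum fun l hl => ?_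
  have h1 := hA l y
  rw [zpow_zero, one_mul] at h1
  have h2 := hB (j - l) (Nat.sub_le _ _) y
  calc _ = (j.choose l : ℝ) * ‖iteratedFDeriv ℝ l χ y‖ *
        ((1 + ‖y‖ ^ 2) ^ k * ‖iteratedFDeriv ℝ (j - l) f y‖) := by ring
    _ ≤ (j.choose l : ℝ) * A l * B := by
        refine mul_le_mul (mul_le_mul_of_nonneg_left h1 (Nat.cast_nonneg _)) h2
          (mul_nonneg hw (norm_nonneg _)) ?_
        exact mul_nonneg (Nat.cast_nonneg _) ((norm_nonneg _).trans h1)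

theorem inStep_mul {k : ℤ} {χ f : Plane → ℂ} (hχ : InStep 0 χ) (hf : InStep k f) :
    InStep k fun y => χ y * f y := by
  choose A hA using hχ.2
  refine ⟨hχ.1.mul hf.1, fun j => ?_⟩
  obtain ⟨B, hB⟩ := exists_weightedBound (f := mk f ⟨k, hf⟩) hf j
  exact ⟨_, weightedBound_mul hχ.1 hf.1 hA hB⟩

/-- Multiplication by a smooth function with bounded derivatives, as a linear map. -/
def mulLM {χ : Plane → ℂ} (hχ : InStep 0 χ) : OC →ₗ[ℂ] OC where
  toFun f := mk (fun y => χ y * f y) (f.exists_inStep.imp fun _ hk => inStep_mul hχ hk)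
  map_add' f g := ext fun y => mul_add (χ y) (f y) (g y)
  map_smul' c f := ext fun y => mul_left_comm (χ y) c (f y)

/-- Multiplication by a smooth function with bounded derivatives, as a continuous operator on
`𝒪_C(ℝ²)`. -/
def mulL {χ : Plane → ℂ} (hχ : InStep 0 χ) : OC →L[ℂ] OC where
  toLinearMap := mulLM hχ
  cont := by
    refine WithSeminorms.continuous_of_isBounded withSeminorms withSeminorms _ fun p => ?_
    have hp : IsStepwiseContinuous (p.1.comp (mulLM hχ)) := by
      intro k
      choose A hA using hχ.2
      have hA0 : ∀ l, 0 ≤ A l := fun l => WeightedBound.nonneg (hA l)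
      obtain ⟨m, C, h⟩ := p.2 k
      set c : ℕ → ℝ := fun j => ∑ l ∈ Finset.range (j + 1), (j.choose l : ℝ) * A l
      have hc0 : ∀ j, 0 ≤ c j := fun j => Finset.sum_nonneg fun l _ =>
        mul_nonneg (Nat.cast_nonneg _) (hA0 l)
      refine ⟨m, C * ∑ j ∈ Finset.range (m + 1), c j, fun f hf B hB => ?_⟩
      have hB0 : 0 ≤ B := WeightedBound.nonneg (hB 0 (Nat.zero_le _))
      rw [mul_assoc]
      refine h (mulLM hχ f) (inStep_mul hχ hf) _ fun j hj y => ?_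
      refine (weightedBound_mul hχ.1 f.contDiff hA (fun l hl => hB l (hl.trans hj)) y).trans ?_
      refine mul_le_mul_of_nonneg_right ?_ hB0
      exact Finset.single_le_sum (f := c) (fun j _ => hc0 j) (Finset.mem_range.2 (by omega))
    refine ⟨{⟨_, hp⟩}, 1, ?_⟩
    simp only [Finset.sup_singleton, one_smul]
    exact le_rfl

theorem mulL_apply {χ : Plane → ℂ} (hχ : InStep 0 χ) (f : OC) (y : Plane) :
    mulL hχ f y = χ y * f y := rfl

theorem partialY_mulL {χ : Plane → ℂ} (hχ : InStep 0 χ) {j : Fin 2}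
    (hj : ∀ (y : Plane) (t : ℝ), χ (y + t • stdVec j) = χ y) (f : OC) :
    partialY j (mulL hχ f) = mulL hχ (partialY j f) := by
  refine ext fun y => ?_
  have h1 := (mulL hχ f).hasDerivAt_line j y 0
  have h2 := (f.hasDerivAt_line j y 0).const_mul (χ y)
  simp only [mulL_apply, hj, zero_smul, add_zero] at h1 h2 ⊢
  exact h1.unique h2

end OC

/-- A smooth function on the plane that is `1` for `yⁱ ≤ 0` and `0` for `yⁱ ≥ 1`. -/
def cutoff (i : Fin 2) (y : Plane) : ℂ := (Real.smoothTransition (1 - y i) : ℂ)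

theorem cutoff_eq_zero {i : Fin 2} {y : Plane} (h : 1 ≤ y i) : cutoff i y = 0 := by
  rw [cutoff, Real.smoothTransition.zero_of_nonpos (by linarith), Complex.ofReal_zero]

theorem cutoff_eq_one {i : Fin 2} {y : Plane} (h : y i ≤ 0) : cutoff i y = 1 := by
  rw [cutoff, Real.smoothTransition.one_of_one_le (by linarith), Complex.ofReal_one]

theorem cutoff_add_stdVec {i j : Fin 2} (hij : j ≠ i) (y : Plane) (t : ℝ) :
    cutoff i (y + t • stdVec j) = cutoff i y := by
  simp [cutoff, stdVec, hij.symm]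

theorem inStep_cutoff (i : Fin 2) : InStep 0 (cutoff i) := by
  set h : ℝ → ℂ := fun t => (Real.smoothTransition (1 - t) : ℂ) with hh
  have hsm : ContDiff ℝ ∞ h :=
    Complex.ofRealCLM.contDiff.comp
      (Real.smoothTransition.contDiff.comp (contDiff_const.sub contDiff_id))
  set L : Plane →L[ℝ] ℝ := EuclideanSpace.proj i with hL
  have hc : cutoff i = h ∘ L := rfl
  refine ⟨hc ▸ hsm.comp L.contDiff, fun j => ?_⟩
  have hconst : ∀ (c : ℂ) (t : ℝ), ‖c‖ ≤ 1 → h =ᶠ[𝓝 t] (fun _ => c) →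
      ‖iteratedFDeriv ℝ j h t‖ ≤ 1 := by
    intro c t hc1 he
    rw [(he.iteratedFDeriv ℝ j).eq_of_nhds]
    rcases Nat.eq_zero_or_pos j with rfl | hj
    · simpa using hc1
    · rw [iteratedFDeriv_const_of_ne hj.ne']
      simp
  obtain ⟨C, hC⟩ := (isCompact_Icc (a := (0 : ℝ)) (b := 1)).exists_bound_of_continuousOn
    (f := iteratedFDeriv ℝ j h) (hsm.continuous_iteratedFDeriv (mod_cast le_top)).continuousOn
  have hall : ∀ t, ‖iteratedFDeriv ℝ j h t‖ ≤ max C 1 := by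
    intro t
    rcases lt_or_ge t 0 with ht | ht
    · refine (hconst 1 t (by simp) ?_).trans (le_max_right _ _)
      filter_upwards [gt_mem_nhds ht] with s hs
      simp only [hh]
      rw [Real.smoothTransition.one_of_one_le (by linarith), Complex.ofReal_one]
    rcases le_or_gt t 1 with ht1 | ht1
    · exact (hC t ⟨ht, ht1⟩).trans (le_max_left _ _)
    · refine (hconst 0 t (by simp) ?_).trans (le_max_right _ _)
      filter_upwards [lt_mem_nhds ht1] with s hs
      simp only [hh]
      rw [Real.smoothTransition.zero_of_nonpos (by linarith), Complex.ofReal_zero]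
  refine ⟨max C 1, fun y => ?_⟩
  rw [zpow_zero, one_mul, hc, L.iteratedFDeriv_comp_right hsm y (mod_cast le_top)]
  refine (ContinuousMultilinearMap.norm_compContinuousLinearMap_le _ _).trans ?_
  have hL1 : ‖L‖ ≤ 1 := ContinuousLinearMap.opNorm_le_bound _ zero_le_one fun v => by
    rw [one_mul]; exact PiLp.norm_apply_le v i
  have hp : ∏ _l : Fin j, ‖L‖ ≤ 1 := Finset.prod_le_one (fun _ _ => norm_nonneg _) fun _ _ => hL1
  exact (mul_le_of_le_one_right (norm_nonneg _) hp).trans (hall _)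

/-! ### Integration along the characteristics of `∂/∂xⁱ - ∂/∂yⁱ` -/

theorem hasDerivAt_integral_of_continuous {h h' : ℝ → ℝ → ℂ}
    (hc : Continuous fun p : ℝ × ℝ => h p.1 p.2) (hc' : Continuous fun p : ℝ × ℝ => h' p.1 p.2)
    (hd : ∀ t s, HasDerivAt (fun t => h t s) (h' t s) t) (N t₀ : ℝ) :
    HasDerivAt (fun t => ∫ s in (0 : ℝ)..N, h t s) (∫ s in (0 : ℝ)..N, h' t₀ s) t₀ := by
  obtain ⟨C, hC⟩ := ((isCompact_closedBall t₀ 1).prod (isCompact_uIcc (a := 0) (b := N))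
    ).exists_bound_of_continuousOn hc'.continuousOn
  have hs : ∀ {k : ℝ → ℝ → ℂ}, (Continuous fun p : ℝ × ℝ => k p.1 p.2) → ∀ t, Continuous (k t) :=
    fun hk t => hk.comp (by fun_prop : Continuous fun s : ℝ => (t, s))
  refine (intervalIntegral.hasDerivAt_integral_of_dominated_loc_of_deriv_le (F := h) (F' := h')
    (bound := fun _ => C) (Metric.closedBall_mem_nhds t₀ one_pos)
    (Eventually.of_forall fun t => (hs hc t).aestronglyMeasurable)
    ((hs hc t₀).intervalIntegrable _ _) (hs hc' t₀).aestronglyMeasurable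
    (Eventually.of_forall fun s hsm t ht => hC (t, s) ⟨ht, Set.uIoc_subset_uIcc hsm⟩)
    intervalIntegrable_const (Eventually.of_forall fun s _ t _ => hd t s)).2

namespace TemperedFamily

variable {φ : (Fin 2 → ℕ) → (Fin 2 → ℕ) → Torus2 → Plane → ℂ}

/-- The derivative along the characteristics of `∂/∂xⁱ - ∂/∂yⁱ`. -/
theorem hasDerivAt_diag (hφ : TemperedFamily φ) (i : Fin 2) (c : ℝ) (x : Torus2) (y : Plane)
    (s : ℝ) : HasDerivAt
      (fun s : ℝ => φ 0 0 (x + torusMk ((-(c * s)) • stdVec i)) (y + (c * s) • stdVec i))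
      (-c * (φ (Pi.single i 1) 0 (x + torusMk ((-(c * s)) • stdVec i)) (y + (c * s) • stdVec i) -
        φ 0 (Pi.single i 1) (x + torusMk ((-(c * s)) • stdVec i)) (y + (c * s) • stdVec i))) s := by
  have hc : ∀ a b, Continuous fun p : ℝ × ℝ =>
      φ a b (x + torusMk (p.1 • stdVec i)) (y + p.2 • stdVec i) := fun a b => by
    have h1 : Continuous fun p : ℝ × ℝ => x + torusMk (p.1 • stdVec i) :=
      continuous_const.add (continuous_torusMk.comp (by fun_prop))
    exact (hφ.continuous a b).comp (h1.prodMk (by fun_prop))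
  have h := hasFDerivAt_of_partials
    (ψ := fun s t => φ 0 0 (x + torusMk (s • stdVec i)) (y + t • stdVec i))
    (fun s t => hφ.hasDerivAt_x_line 0 0 i x (y + t • stdVec i) s)
    (fun s t => (hφ.partialFamily 0 (x + torusMk (s • stdVec i))).hasDerivAt_line 0 i y t)
    (hc _ _) (hc _ _) (-(c * s), c * s)
  have hl : HasDerivAt (fun s : ℝ => (-(c * s), c * s)) (-c, c) s := by
    have : HasDerivAt (fun s : ℝ => c * s) c s := by simpa using (hasDerivAt_id s).const_mul c
    exact this.fun_neg.prodMk this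
  refine (h.comp_hasDerivAt s hl).congr_deriv ?_
  simp only [ContinuousLinearMap.coprod_apply, ContinuousLinearMap.toSpanSingleton_apply, zero_add,
    Complex.real_smul]
  push_cast
  ring

/-- The derivatives of a function that vanishes on a half-plane vanish there. -/
theorem eq_zero_of_lt (hφ : TemperedFamily φ) {i : Fin 2} {σ : ℝ}
    (h : ∀ x y, 1 < σ * y i → φ 0 0 x y = 0) (a b : Fin 2 → ℕ) :
    ∀ x y, 1 < σ * y i → φ a b x y = 0 := by
  have h1 : ∀ b x y, 1 < σ * y i → φ 0 b x y = 0 := fun b => by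
    induction b using multiIndex_induction with
    | h0 => exact h
    | hs b k ih =>
      intro x y hy
      refine (hφ.hasDerivAt_y 0 b k x y).unique ?_
      refine (hasDerivAt_const (0 : ℝ) (0 : ℂ)).congr_of_eventuallyEq ?_
      have hcont : Continuous fun t : ℝ => σ * (y + t • stdVec k) i := by fun_prop
      have hev := (hcont.tendsto 0).eventually (lt_mem_nhds (by simpa using hy))
      filter_upwards [hev] with t ht
      exact ih x _ ht
  induction a using multiIndex_induction with
  | h0 => exact h1 b
  | hs a k ih =>
    intro x y hy
    refine (hφ.hasDerivAt_x a b k x y).unique ?_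
    refine (hasDerivAt_const (0 : ℝ) (0 : ℂ)).congr_of_eventuallyEq ?_
    exact Eventually.of_forall fun t => ih _ y hy

end TemperedFamily

/-- The integral of `φ` over the half-line `(x - σ s eᵢ, y + σ s eᵢ)`, `s ≥ 0`, for a family `φ`
that vanishes where `σ yⁱ > 1`; the half-line is truncated where `φ` is known to vanish. -/
def rayIntegral (i : Fin 2) (σ : ℝ) (φ : (Fin 2 → ℕ) → (Fin 2 → ℕ) → Torus2 → Plane → ℂ)
    (a b : Fin 2 → ℕ) (x : Torus2) (y : Plane) : ℂ :=
  ∫ s in (0 : ℝ)..(|y i| + 2), φ a b (x + torusMk ((-(σ * s)) • stdVec i)) (y + (σ * s) • stdVec i)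

section RayIntegral

variable {φ : (Fin 2 → ℕ) → (Fin 2 → ℕ) → Torus2 → Plane → ℂ} {i : Fin 2} {σ : ℝ}

theorem TemperedFamily.continuous_ray (hφ : TemperedFamily φ) (a b : Fin 2 → ℕ) :
    Continuous fun q : (Torus2 × Plane) × ℝ =>
      φ a b (q.1.1 + torusMk ((-(σ * q.2)) • stdVec i)) (q.1.2 + (σ * q.2) • stdVec i) := by
  have h1 : Continuous fun q : (Torus2 × Plane) × ℝ =>
      q.1.1 + torusMk ((-(σ * q.2)) • stdVec i) :=
    (continuous_fst.comp continuous_fst).add (continuous_torusMk.comp (by fun_prop))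
  exact (hφ.continuous a b).comp (h1.prodMk (by fun_prop))

theorem rayIntegral_eq (hφ : TemperedFamily φ) (hσ : σ * σ = 1)
    (h : ∀ x y, 1 < σ * y i → φ 0 0 x y = 0) (a b : Fin 2 → ℕ) (x : Torus2) {y : Plane} {N : ℝ}
    (hN : |y i| + 1 ≤ N) : rayIntegral i σ φ a b x y =
      ∫ s in (0 : ℝ)..N, φ a b (x + torusMk ((-(σ * s)) • stdVec i)) (y + (σ * s) • stdVec i) := by
  have key : ∀ N, |y i| + 1 ≤ N →
      ∫ s in (0 : ℝ)..N, φ a b (x + torusMk ((-(σ * s)) • stdVec i)) (y + (σ * s) • stdVec i) =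
      ∫ s in (0 : ℝ)..(|y i| + 1),
        φ a b (x + torusMk ((-(σ * s)) • stdVec i)) (y + (σ * s) • stdVec i) := by
    intro N hN
    have hc : Continuous fun s : ℝ =>
        φ a b (x + torusMk ((-(σ * s)) • stdVec i)) (y + (σ * s) • stdVec i) :=
      (hφ.continuous_ray a b).comp (by fun_prop : Continuous fun s : ℝ => ((x, y), s))
    rw [← intervalIntegral.integral_add_adjacent_intervals (hc.intervalIntegrable 0 (|y i| + 1))
      (hc.intervalIntegrable (|y i| + 1) N), add_eq_left]
    refine intervalIntegral.integral_zero_ae (Eventually.of_forall fun s hs => ?_)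
    rw [Set.uIoc_of_le hN] at hs
    refine hφ.eq_zero_of_lt h a b _ _ ?_
    have hy : -|y i| ≤ σ * y i := by
      have h1 : |σ * y i| = |y i| := by
        have : |σ| = 1 := by
          rcases mul_self_eq_one_iff.1 hσ with rfl | rfl <;> simp
        rw [abs_mul, this, one_mul]
      rw [← h1]
      exact neg_abs_le _
    have h2 : σ * (y + (σ * s) • stdVec i) i = σ * y i + s := by
      simp only [stdVec, PiLp.add_apply, PiLp.smul_apply, PiLp.single_apply, if_true, smul_eq_mul]
      linear_combination s * hσ
    rw [h2]
    linarith [hs.1]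
  rw [rayIntegral, key _ hN, key _ (by linarith)]

/-- Integration along rays preserves tempered families: as it commutes with all derivatives, the
exponents of growth increase only by one. -/
theorem TemperedFamily.rayIntegral (hφ : TemperedFamily φ) (hσ : σ * σ = 1)
    (h : ∀ x y, 1 < σ * y i → φ 0 0 x y = 0) : TemperedFamily (rayIntegral i σ φ) where
  continuous a b := by
    refine continuous_iff_continuousAt.2 fun q => ?_
    have hc : Continuous fun q : Torus2 × Plane => ∫ s in (0 : ℝ)..(|q.2 i| + 2),
        φ a b (q.1 + torusMk ((-(σ * s)) • stdVec i)) (q.2 + (σ * s) • stdVec i) :=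
      intervalIntegral.continuous_parametric_intervalIntegral_of_continuous
        (f := fun (q : Torus2 × Plane) s =>
          φ a b (q.1 + torusMk ((-(σ * s)) • stdVec i)) (q.2 + (σ * s) • stdVec i))
        (hφ.continuous_ray a b) (by fun_prop)
    exact hc.continuousAt
  hasDerivAt_x a b k x y := by
    have hc : ∀ a b, Continuous fun p : ℝ × ℝ => φ a b
        (x + torusMk (p.1 • stdVec k) + torusMk ((-(σ * p.2)) • stdVec i))
        (y + (σ * p.2) • stdVec i) := fun a b => by
      have h1 : Continuous fun p : ℝ × ℝ => x + torusMk (p.1 • stdVec k) :=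
        continuous_const.add (continuous_torusMk.comp (by fun_prop))
      exact (hφ.continuous_ray a b).comp ((h1.prodMk continuous_const).prodMk continuous_snd)
    have := hasDerivAt_integral_of_continuous (hc a b) (hc (a + Pi.single k 1) b)
      (fun t s => by
        have := hφ.hasDerivAt_x_line a b k (x + torusMk ((-(σ * s)) • stdVec i))
          (y + (σ * s) • stdVec i) t
        simpa only [add_right_comm] using this) (|y i| + 2) 0
    simpa only [_root_.rayIntegral, zero_smul, torusMk_zero, add_zero] using this
  hasDerivAt_y a b k x y := by
    have hc : ∀ a b, Continuous fun p : ℝ × ℝ => φ a b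
        (x + torusMk ((-(σ * p.2)) • stdVec i))
        (y + p.1 • stdVec k + (σ * p.2) • stdVec i) := fun a b =>
      (hφ.continuous_ray a b).comp ((continuous_const.prodMk (by fun_prop)).prodMk continuous_snd)
    have := hasDerivAt_integral_of_continuous (hc a b) (hc a (b + Pi.single k 1))
      (fun t s => by
        have := (hφ.partialFamily a (x + torusMk ((-(σ * s)) • stdVec i))).hasDerivAt_line b k
          (y + (σ * s) • stdVec i) t
        simpa only [add_right_comm] using this) (|y i| + 2) 0
    simp only [zero_smul, add_zero] at this
    refine this.congr_of_eventuallyEq ?_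
    have hcont : Continuous fun t : ℝ => |(y + t • stdVec k) i| := by fun_prop
    have h0 : |(y + (0 : ℝ) • stdVec k) i| < |y i| + 1 := by simp
    have hev := (hcont.tendsto 0).eventually (gt_mem_nhds h0)
    filter_upwards [hev] with t ht
    exact rayIntegral_eq hφ hσ h a b x (by linarith)
  growth a := by
    obtain ⟨K, hK⟩ := hφ.growth a
    refine ⟨K + 1, fun b => ?_⟩
    obtain ⟨C, hC0, hC⟩ := hK b
    refine ⟨3 * C * 9 ^ K, by positivity, fun x y => ?_⟩
    have hyi : |y i| ≤ ‖y‖ := PiLp.norm_apply_le y i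
    have hσ1 : |σ| = 1 := by rcases mul_self_eq_one_iff.1 hσ with rfl | rfl <;> simp
    have hbd : ∀ s ∈ Set.uIoc (0 : ℝ) (|y i| + 2),
        ‖φ a b (x + torusMk ((-(σ * s)) • stdVec i)) (y + (σ * s) • stdVec i)‖ ≤
          C * (9 * (1 + ‖y‖ ^ 2)) ^ K := by
      intro s hs
      rw [Set.uIoc_of_le (by positivity)] at hs
      refine (hC _ _).trans (mul_le_mul_of_nonneg_left ?_ hC0)
      refine pow_le_pow_left₀ (by positivity) ?_ K
      have h1 : ‖y + (σ * s) • stdVec i‖ ≤ 2 * ‖y‖ + 2 := by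
        refine (norm_add_le _ _).trans ?_
        rw [norm_smul, Real.norm_eq_abs, abs_mul, hσ1, abs_of_pos hs.1]
        have h2 : ‖stdVec i‖ = 1 := by simp [stdVec]
        rw [h2]
        linarith [hs.2]
      have h2 := pow_le_pow_left₀ (norm_nonneg _) h1 2
      nlinarith [sq_nonneg (‖y‖ - 1)]
    refine (intervalIntegral.norm_integral_le_of_norm_le_const hbd).trans ?_
    rw [sub_zero, abs_of_nonneg (by positivity), mul_pow, pow_succ (1 + ‖y‖ ^ 2) K]
    have h3 : |y i| + 2 ≤ 3 * (1 + ‖y‖ ^ 2) := by nlinarith [sq_nonneg (‖y‖ - 1)]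
    calc _ ≤ C * (9 ^ K * (1 + ‖y‖ ^ 2) ^ K) * (3 * (1 + ‖y‖ ^ 2)) := by gcongr
      _ = _ := by ring

end RayIntegral

theorem Sections.smul_val (c : ℂ) (F : Sections) (x : Torus2) (y : Plane) :
    (c • F).val x y = c * F.val x y := rfl

theorem Sections.zero_val (x : Torus2) (y : Plane) : (0 : Sections).val x y = 0 := rfl

theorem Sections.sub_val (F G : Sections) (x : Torus2) (y : Plane) :
    (F - G).val x y = F.val x y - G.val x y := rfl

/-- The equation `(∂/∂xⁱ - ∂/∂yⁱ) Ψ = σ Φ` for a section supported in a half-plane. -/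
theorem exists_secD_eq_of_support {i : Fin 2} {σ : ℝ} (hσ : σ * σ = 1) {Φ : Sections}
    (h : ∀ x (y : Plane), 1 < σ * y i → Φ.val x y = 0) :
    ∃ Ψ : Sections, secD i Ψ = (σ : ℂ) • Φ ∧ ∀ j, secD j Φ = 0 → secD j Ψ = 0 := by
  obtain ⟨φ, hφ, hφ0⟩ := exists_temperedFamily Φ
  have hsupp : ∀ x y, 1 < σ * y i → φ 0 0 x y = 0 := fun x y hy => by rw [hφ0, h x y hy]
  have hψ := hφ.rayIntegral hσ hsupp
  have hcr : ∀ a b x y, Continuous fun s : ℝ =>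
      φ a b (x + torusMk ((-(σ * s)) • stdVec i)) (y + (σ * s) • stdVec i) := fun a b x y =>
    (hφ.continuous_ray a b).comp (by fun_prop : Continuous fun s : ℝ => ((x, y), s))
  have hsec : ∀ j x y, (secD j hψ.toSection).val x y = ∫ s in (0 : ℝ)..(|y i| + 2),
      (φ (Pi.single j 1) 0 (x + torusMk ((-(σ * s)) • stdVec i)) (y + (σ * s) • stdVec i) -
        φ 0 (Pi.single j 1) (x + torusMk ((-(σ * s)) • stdVec i)) (y + (σ * s) • stdVec i)) := by
    intro j x y
    rw [hψ.secD_val (fun x y => rfl), intervalIntegral.integral_sub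
      ((hcr _ _ x y).intervalIntegrable _ _) ((hcr _ _ x y).intervalIntegrable _ _)]
    rfl
  refine ⟨hψ.toSection, Sections.ext fun x y => ?_, fun j hj => Sections.ext fun x y => ?_⟩
  · rw [hsec, Sections.smul_val]
    have hσc : (σ : ℂ) * σ = 1 := by exact_mod_cast hσ
    have hftc := intervalIntegral.integral_eq_sub_of_hasDerivAt
      (fun s _ => hφ.hasDerivAt_diag i σ x y s) (a := 0) (b := |y i| + 2)
      ((continuous_const.mul ((hcr _ _ x y).sub (hcr _ _ x y))).intervalIntegrable _ _)
    have hend : φ 0 0 (x + torusMk ((-(σ * (|y i| + 2))) • stdVec i))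
        (y + (σ * (|y i| + 2)) • stdVec i) = 0 := by
      refine hsupp _ _ ?_
      simp only [stdVec, PiLp.add_apply, PiLp.smul_apply, PiLp.single_apply, if_true, smul_eq_mul]
      have h2 : σ * (y i + σ * (|y i| + 2) * 1) = σ * y i + (|y i| + 2) := by
        linear_combination (|y i| + 2) * hσ
      rw [h2]
      rcases mul_self_eq_one_iff.1 hσ with rfl | rfl
      · linarith [neg_abs_le (y i)]
      · linarith [le_abs_self (y i)]
    rw [hend, intervalIntegral.integral_const_mul] at hftc
    simp only [mul_zero, neg_zero, zero_smul, torusMk_zero, add_zero, zero_sub, hφ0] at hftc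
    linear_combination (-(σ : ℂ)) * hftc - (∫ s in (0 : ℝ)..(|y i| + 2),
      (φ (Pi.single i 1) 0 (x + torusMk ((-(σ * s)) • stdVec i)) (y + (σ * s) • stdVec i) -
        φ 0 (Pi.single i 1) (x + torusMk ((-(σ * s)) • stdVec i)) (y + (σ * s) • stdVec i))) * hσc
  · rw [hsec, Sections.zero_val]
    have hz : ∀ x y, φ (Pi.single j 1) 0 x y - φ 0 (Pi.single j 1) x y = 0 := fun x y => by
      rw [← hφ.secD_val hφ0, hj, Sections.zero_val]
    simp [hz]

theorem torusPartial_smoothTorusMap (j : Fin 2) (L : OC →L[ℂ] OC) (F : smoothTorus OC) :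
    torusPartial j (smoothTorusMap L F) = smoothTorusMap L (torusPartial j F) := by
  refine Subtype.ext ((torusPartial_spec j (smoothTorusMap L F)).unique fun x => ?_)
  refine ((L.continuous.tendsto _).comp (torusPartial_spec j F x)).congr fun t => ?_
  simp [smoothTorusMap]

theorem secD_smoothTorusMap {j : Fin 2} {L : OC →L[ℂ] OC}
    (hL : ∀ f, OC.partialY j (L f) = L (OC.partialY j f)) (F : smoothTorus OC) :
    torusPartial j (smoothTorusMap L F) - smoothTorusMap (OC.partialY j) (smoothTorusMap L F) =
      smoothTorusMap L (torusPartial j F - smoothTorusMap (OC.partialY j) F) := by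
  rw [torusPartial_smoothTorusMap, map_sub]
  congr 1
  exact Subtype.ext (funext fun x => hL (F.1 x))

/-- The operator `∂/∂xⁱ - ∂/∂yⁱ` on sections has a right inverse that preserves the kernels of the
other such operators. -/
theorem exists_secD_eq (i : Fin 2) (F : Sections) :
    ∃ G : Sections, secD i G = F ∧ ∀ j ≠ i, secD j F = 0 → secD j G = 0 := by
  -- The two parts of `F` live on `yⁱ ≤ 1` and on `yⁱ ≥ 0`.
  set L := OC.mulL (inStep_cutoff i) with hL
  set F₁ : Sections := (smoothTorusMap L (F : smoothTorus OC) : smoothTorus OC) with hF₁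
  have hF₁v : ∀ x y, F₁.val x y = cutoff i y * F.val x y := fun x y => rfl
  obtain ⟨G₁, hG₁, hk₁⟩ := exists_secD_eq_of_support (i := i) (σ := 1) (by norm_num) (Φ := F₁)
    fun x y hy => by rw [hF₁v, cutoff_eq_zero (by linarith), zero_mul]
  obtain ⟨G₂, hG₂, hk₂⟩ := exists_secD_eq_of_support (i := i) (σ := -1) (by norm_num)
    (Φ := F - F₁) fun x y hy => by
      rw [Sections.sub_val, hF₁v, cutoff_eq_one (by linarith), one_mul, sub_self]
  refine ⟨G₁ - G₂, ?_, fun j hj hF => ?_⟩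
  · rw [map_sub, hG₁, hG₂]
    push_cast
    simp
  · have h1 : secD j F₁ = 0 := by
      have : secD j F₁ = (smoothTorusMap L (secD j F : smoothTorus OC) : smoothTorus OC) := by
        exact secD_smoothTorusMap (OC.partialY_mulL _ (cutoff_add_stdVec hj)) F
      rw [this, hF]
      exact map_zero (smoothTorusMap L)
    rw [map_sub, hk₁ j h1, hk₂ j (by rw [map_sub, hF, h1, sub_zero]), sub_zero]

/-! ### The differential `Q` -/

theorem torusPartial_comm {E : Type} [AddCommGroup E] [Module ℂ E] [TopologicalSpace E]
    [IsTopologicalAddGroup E] [ContinuousConstSMul ℂ E] [T2Space E] (i j : Fin 2)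
    (F : smoothTorus E) : torusPartial i (torusPartial j F) = torusPartial j (torusPartial i F) := by
  obtain ⟨D, hD0, hD⟩ := F.2
  have key : ∀ i j, (torusPartial i (torusPartial j F)).1 = D (Pi.single j 1 + Pi.single i 1) := by
    intro i j
    have h1 : (torusPartial j F).1 = D (Pi.single j 1) := by
      have h := (hD 0).2 j
      rw [hD0, zero_add] at h
      exact (torusPartial_spec j F).unique h
    have h := (hD (Pi.single j 1)).2 i
    rw [← h1] at h
    exact (torusPartial_spec i _).unique h
  exact Subtype.ext (by rw [key, key, add_comm])

theorem secD_comm (i j : Fin 2) (F : Sections) : secD i (secD j F) = secD j (secD i F) := by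
  have key : ∀ (i j : Fin 2) (F : smoothTorus OC), secD i (secD j F) =
      (torusPartial i (torusPartial j F) - smoothTorusMap (OC.partialY i) (torusPartial j F) -
        smoothTorusMap (OC.partialY j) (torusPartial i F) +
        smoothTorusMap (OC.partialY i) (smoothTorusMap (OC.partialY j) F) : smoothTorus OC) := by
    intro i j F
    change torusPartial i (torusPartial j F - smoothTorusMap (OC.partialY j) F) -
      smoothTorusMap (OC.partialY i) (torusPartial j F - smoothTorusMap (OC.partialY j) F) = _
    rw [map_sub, map_sub, torusPartial_smoothTorusMap]
    abel
  have hy : ∀ F : smoothTorus OC, smoothTorusMap (OC.partialY i) (smoothTorusMap (OC.partialY j) F) =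
      smoothTorusMap (OC.partialY j) (smoothTorusMap (OC.partialY i) F) := fun F =>
    Subtype.ext (funext fun x => OC.partialY_comm i j (F.1 x))
  refine (key i j F).trans (Eq.trans ?_ (key j i F).symm)
  rw [sub_right_comm]
  exact congrArg₂ _ (congrArg (fun G => G - _ - _) (torusPartial_comm i j F)) (hy F)

theorem alternatingMap_sum_apply {R M N ι κ : Type*} [CommSemiring R] [AddCommMonoid M]
    [Module R M] [AddCommMonoid N] [Module R N] (s : Finset κ) (f : κ → M [⋀^ι]→ₗ[R] N)
    (v : ι → M) : (∑ k ∈ s, f k) v = ∑ k ∈ s, f k v :=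
  map_sum (⟨⟨fun g : M [⋀^ι]→ₗ[R] N => g v, rfl⟩, fun _ _ => rfl⟩ : (M [⋀^ι]→ₗ[R] N) →+ N) f s

theorem Q_apply (p : ℕ) (η : Forms p) (v : Fin (p + 1) → Plane) :
    Q p η v = ∑ i, ∑ k : Fin (p + 1), (-1 : ℤ) ^ (k : ℕ) • (v k i) • secD i (η (k.removeNth v)) := by
  simp only [Q, LinearMap.sum_apply, alternatingMap_sum_apply]
  refine Finset.sum_congr rfl fun i _ => ?_
  exact AlternatingMap.alternatizeUncurryFin_apply _ _

theorem formD_apply (p : ℕ) (i : Fin 2) (η : Forms p) (v : Fin p → Plane) :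
    formD p i η v = secD i (η v) := rfl

theorem secD_real_smul (i : Fin 2) (r : ℝ) (F : Sections) : secD i (r • F) = r • secD i F :=
  ((secD i).restrictScalars ℝ).map_smul r F

theorem formD_Q (p : ℕ) (i : Fin 2) (η : Forms p) :
    formD (p + 1) i (Q p η) = Q p (formD p i η) := by
  ext1 v
  rw [formD_apply, Q_apply, Q_apply, map_sum]
  refine Finset.sum_congr rfl fun j _ => ?_
  rw [map_sum]
  refine Finset.sum_congr rfl fun k _ => ?_
  rw [map_zsmul, secD_real_smul, secD_comm, formD_apply]

/-- The one-form `∑ᵢ dxⁱ ⊗ (∂/∂xⁱ - ∂/∂yⁱ) η`, whose antisymmetrization is `Q η`. -/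
def covariantDeriv (p : ℕ) (η : Forms p) : Plane →ₗ[ℝ] Forms p :=
  ∑ i, (EuclideanSpace.proj i : Plane →L[ℝ] ℝ).toLinearMap.smulRight (formD p i η)

theorem covariantDeriv_apply (p : ℕ) (η : Forms p) (v : Plane) :
    covariantDeriv p η v = ∑ i, v i • formD p i η := by
  simp [covariantDeriv]

theorem Q_eq (p : ℕ) (η : Forms p) :
    Q p η = AlternatingMap.alternatizeUncurryFin (covariantDeriv p η) := by
  ext1 v
  rw [Q_apply, AlternatingMap.alternatizeUncurryFin_apply, Finset.sum_comm]
  refine Finset.sum_congr rfl fun k _ => ?_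
  rw [covariantDeriv_apply, alternatingMap_sum_apply, Finset.smul_sum]
  rfl

/-- `Q² = 0`: the twofold covariant derivative is symmetric, so its antisymmetrization vanishes. -/
theorem Q_Q (p : ℕ) (η : Forms p) : Q (p + 1) (Q p η) = 0 := by
  set f : Plane →ₗ[ℝ] Plane →ₗ[ℝ] Forms p := ∑ i,
    (EuclideanSpace.proj i : Plane →L[ℝ] ℝ).toLinearMap.smulRight
      (covariantDeriv p (formD p i η)) with hf
  have hfa : ∀ v w, f v w = ∑ i, ∑ j, (v i * w j) • formD p j (formD p i η) := by
    intro v w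
    simp [hf, covariantDeriv_apply, mul_smul]
  have hfs : ∀ v w, f v w = f w v := by
    intro v w
    rw [hfa, hfa, Finset.sum_comm]
    refine Finset.sum_congr rfl fun i _ => Finset.sum_congr rfl fun j _ => ?_
    have hc : formD p i (formD p j η) = formD p j (formD p i η) := by
      ext1 u
      exact secD_comm i j _
    rw [hc, mul_comm]
  rw [Q_eq, ← AlternatingMap.alternatizeUncurryFin_alternatizeUncurryFinLM_comp_of_symmetric hfs]
  congr 1
  refine LinearMap.ext fun v => ?_
  rw [covariantDeriv_apply]
  simp only [formD_Q]
  simp [hf, Q_eq]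

/-! ### Vanishing of the cohomology in positive degrees -/

theorem Forms.ext_stdVec {p : ℕ} {η θ : Forms p}
    (h : ∀ v : Fin p → Fin 2, Function.Injective v →
      η (fun k => stdVec (v k)) = θ fun k => stdVec (v k)) : η = θ := by
  refine (EuclideanSpace.basisFun (Fin 2) ℝ).toBasis.ext_alternating fun v hv => ?_
  simpa [stdVec] using h v hv

theorem Q_zero_apply (η : Forms 0) (v : Fin 1 → Plane) :
    Q 0 η v = ∑ i, v 0 i • secD i (η ![]) := by
  rw [Q_apply]
  refine Finset.sum_congr rfl fun i _ => ?_
  rw [Fin.sum_univ_one]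
  simp only [Fin.val_zero, pow_zero, one_smul]
  congr 3
  exact Subsingleton.elim _ _

theorem Q_zero_stdVec (η : Forms 0) (i : Fin 2) : Q 0 η ![stdVec i] = secD i (η ![]) := by
  rw [Q_zero_apply]
  fin_cases i <;> simp [stdVec]

theorem Q_one_stdVec (η : Forms 1) :
    Q 1 η ![stdVec 0, stdVec 1] = secD 0 (η ![stdVec 1]) - secD 1 (η ![stdVec 0]) := by
  rw [Q_apply]
  have h1 : (1 : Fin 2).removeNth ![stdVec 0, stdVec 1] = ![stdVec 0] := by
    ext1 k; fin_cases k; rfl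
  simp [Fin.sum_univ_two, stdVec, sub_eq_add_neg]
  exact congrArg (fun v => secD 1 (η v)) h1

theorem Q_zero_eq_zero_iff (η : Forms 0) : Q 0 η = 0 ↔ ∀ i, secD i (η ![]) = 0 := by
  refine ⟨fun h i => by rw [← Q_zero_stdVec, h]; rfl, fun h => ?_⟩
  ext1 v
  rw [Q_zero_apply]
  simp [h]

/-- The form of degree `0` given by a section. -/
def zeroForm (F : Sections) : Forms 0 := AlternatingMap.constOfIsEmpty ℝ Plane (Fin 0) F

theorem zeroForm_apply (F : Sections) (v : Fin 0 → Plane) : zeroForm F v = F := rfl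

/-- A closed one-form is exact: first the equation for `dx⁰` is solved, and the remaining error in
the equation for `dx¹` is corrected within the kernel of `∂/∂x⁰ - ∂/∂y⁰`. -/
theorem exists_Q_eq_of_degree_one {η : Forms 1} (hη : Q 1 η = 0) : ∃ θ, Q 0 θ = η := by
  obtain ⟨u, hu, -⟩ := exists_secD_eq 0 (η ![stdVec 0])
  have hw : secD 0 (η ![stdVec 1] - secD 1 u) = 0 := by
    rw [map_sub, secD_comm, hu, ← Q_one_stdVec, hη]
    rfl
  obtain ⟨w, hw1, hw0⟩ := exists_secD_eq 1 (η ![stdVec 1] - secD 1 u)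
  refine ⟨zeroForm (u + w), Forms.ext_stdVec fun v _ => ?_⟩
  have hv : (fun k => stdVec (v k)) = ![stdVec (v 0)] := by
    ext1 k; fin_cases k; rfl
  rw [hv, Q_zero_stdVec, zeroForm_apply]
  generalize v 0 = i
  fin_cases i
  · simp [hu, hw0 0 (by simp) hw]
  · simp [hw1]

theorem exists_Q_eq_of_degree_two (η : Forms 2) : ∃ θ, Q 1 θ = η := by
  obtain ⟨u, hu, -⟩ := exists_secD_eq 0 (η ![stdVec 0, stdVec 1])
  set θ : Forms 1 := AlternatingMap.ofSubsingleton ℝ Plane Sections (0 : Fin 1)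
    ((EuclideanSpace.proj 1 : Plane →L[ℝ] ℝ).toLinearMap.smulRight u) with hθ
  have h01 : Q 1 θ ![stdVec 0, stdVec 1] = η ![stdVec 0, stdVec 1] := by
    rw [Q_one_stdVec, ← hu]
    simp [hθ, stdVec]
  refine ⟨θ, Forms.ext_stdVec fun v hv => ?_⟩
  have hv' : (fun k => stdVec (v k)) = ![stdVec (v 0), stdVec (v 1)] := by
    ext1 k; fin_cases k <;> rfl
  have hne : v 0 ≠ v 1 := fun h => absurd (hv h) (by simp)
  have hswap : ∀ ζ : Forms 2, ζ ![stdVec 1, stdVec 0] = -ζ ![stdVec 0, stdVec 1] := fun ζ => by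
    rw [← ζ.map_swap ![stdVec 0, stdVec 1] (i := 0) (j := 1) (by simp)]
    congr 1
    ext1 k; fin_cases k <;> simp
  rw [hv']
  generalize v 0 = i at *
  generalize v 1 = j at *
  fin_cases i <;> fin_cases j
  · exact absurd rfl hne
  · exact h01
  · exact (hswap _).trans ((congrArg Neg.neg h01).trans (hswap _).symm)
  · exact absurd rfl hne

theorem cocycles_le_coboundaries (p : ℕ) : cocycles (p + 1) ≤ coboundaries (p + 1) := by
  intro η hη
  match p, η, hη with
  | 0, η, hη => exact exists_Q_eq_of_degree_one hη
  | 1, η, _ => exact exists_Q_eq_of_degree_two η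
  | p + 2, η, _ =>
    have : η = 0 := Forms.ext_stdVec fun v hv => by
      have := Fintype.card_le_of_injective v hv
      simp at this
    rw [this]
    exact zero_mem _

theorem subsingleton_cohomology (p : ℕ) : Subsingleton (Cohomology (p + 1)) := by
  rw [Submodule.Quotient.subsingleton_iff, Submodule.submoduleOf, eq_top_iff]
  exact fun η _ => cocycles_le_coboundaries p η.2

/-! ### The cohomology in degree zero -/

/-- A section killed by all `∂/∂xⁱ - ∂/∂yⁱ` is constant along the lines `(x + s v, y - s v)`. -/
theorem Sections.val_eq_of_secD_eq_zero {F : Sections} (hF : ∀ i, secD i F = 0) (x : Torus2)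
    (y : Plane) : F.val x y = F.val (x + torusMk y) 0 := by
  obtain ⟨φ, hφ, hφ0⟩ := exists_temperedFamily F
  have hstep : ∀ i x (y : Plane) (s : ℝ),
      F.val x y = F.val (x + torusMk (s • stdVec i)) (y + (-s) • stdVec i) := by
    intro i x y s
    have hd : ∀ s, HasDerivAt (fun s : ℝ => φ 0 0 (x + torusMk ((-(-1 * s)) • stdVec i))
        (y + (-1 * s) • stdVec i)) 0 s := fun s => by
      have h := hφ.hasDerivAt_diag i (-1) x y s
      rwa [← hφ.secD_val hφ0, hF, Sections.zero_val, mul_zero] at h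
    have h := is_const_of_deriv_eq_zero (fun s => (hd s).differentiableAt)
      (fun s => (hd s).deriv) 0 s
    simpa [hφ0, torusMk_zero] using h
  rw [hstep 0 x y (y 0), hstep 1 _ _ (y 1), add_assoc, ← torusMk_add, ← eq_sum_stdVec]
  congr 1
  conv_lhs => enter [1, 1]; rw [eq_sum_stdVec y]
  module

/-- The restriction of a section to `y = 0`. -/
def restrictZero : Sections →ₗ[ℂ] smoothTorus ℂ where
  toFun F := ⟨fun x => F.val x 0, by
    obtain ⟨F, D, rfl, hD⟩ := F
    refine ⟨fun a x => D a x 0, rfl, fun a => ⟨(OC.evalL 0).continuous.comp (hD a).1,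
      fun i => ((hD a).2 i).clm_comp (OC.evalL 0)⟩⟩⟩
  map_add' _ _ := rfl
  map_smul' _ _ := rfl

/-- A smooth function `g` on the torus defines the horizontal section `g(x + y)`. -/
theorem exists_section_eq_comp_add (g : smoothTorus ℂ) :
    ∃ F : Sections, (∀ x y, F.val x y = g.1 (x + torusMk y)) ∧ ∀ i, secD i F = 0 := by
  obtain ⟨D, hD0, hD⟩ := g.2
  have hφ : TemperedFamily fun a b x y => D (a + b) (x + torusMk y) :=
    { continuous := fun a b =>
        (hD (a + b)).1.comp (continuous_fst.add (continuous_torusMk.comp continuous_snd))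
      hasDerivAt_x := fun a b i x y => by
        have h := ((hD (a + b)).2 i).hasDerivAt (x + torusMk y)
        simpa only [add_right_comm] using h
      hasDerivAt_y := fun a b i x y => by
        have h := ((hD (a + b)).2 i).hasDerivAt (x + torusMk y)
        simpa only [torusMk_add, add_assoc] using h
      growth := fun a => ⟨0, fun b => by
        obtain ⟨C, hC⟩ := (isCompact_univ (X := Torus2)).exists_bound_of_continuousOn
          (hD (a + b)).1.continuousOn
        refine ⟨C, (norm_nonneg _).trans (hC 0 (Set.mem_univ _)), fun x y => ?_⟩
        simpa using hC (x + torusMk y) (Set.mem_univ _)⟩ }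
  refine ⟨hφ.toSection, fun x y => ?_, fun i => Sections.ext fun x y => ?_⟩
  · rw [hφ.toSection_val, add_zero, hD0]
  · rw [hφ.secD_val (fun x y => rfl), add_zero, zero_add, sub_self, Sections.zero_val]

theorem formFun_eq_restrictZero (η : Forms 0) (h : Q 0 η = 0) (x : Torus2) (y : Plane) :
    formFun η x y = (restrictZero (η ![])).1 (x + torusMk y) :=
  Sections.val_eq_of_secD_eq_zero ((Q_zero_eq_zero_iff η).1 h) x y

theorem Q_zero_eq_zero_iff_exists (η : Forms 0) : Q 0 η = 0 ↔
    ∃ g : smoothTorus ℂ, ∀ (x : Torus2) (y : Plane), formFun η x y = g.1 (x + torusMk y) := by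
  refine ⟨fun h => ⟨_, formFun_eq_restrictZero η h⟩, fun ⟨g, hg⟩ => ?_⟩
  obtain ⟨F, hF, hF0⟩ := exists_section_eq_comp_add g
  have he : η ![] = F := Sections.ext fun x y => (hg x y).trans (hF x y).symm
  exact (Q_zero_eq_zero_iff η).2 fun i => by rw [he, hF0]

/-- The restriction of a closed form of degree `0` to `y = 0`. -/
def restrictCocycle : cocycles 0 →ₗ[ℂ] smoothTorus ℂ where
  toFun η := restrictZero (η.1 ![])
  map_add' _ _ := rfl
  map_smul' _ _ := rfl

theorem restrictCocycle_bijective : Function.Bijective restrictCocycle := by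
  refine ⟨(injective_iff_map_eq_zero _).2 fun η hη => Subtype.ext ?_, fun g => ?_⟩
  · ext1 v
    rw [Subsingleton.elim v ![]]
    refine Sections.ext fun x y => ?_
    refine (formFun_eq_restrictZero η.1 η.2 x y).trans ?_
    exact congrFun (congrArg Subtype.val hη) (x + torusMk y)
  · obtain ⟨F, hF, hF0⟩ := exists_section_eq_comp_add g
    refine ⟨⟨zeroForm F, (Q_zero_eq_zero_iff _).2 hF0⟩, Subtype.ext (funext fun x => ?_)⟩
    refine (hF x 0).trans ?_
    rw [torusMk_zero, add_zero]

end

theorem theorem2 :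
    (∀ (p : ℕ) (η : Forms p), Q (p + 1) (Q p η) = 0) ∧
    (∀ p : ℕ, Subsingleton (Cohomology (p + 1))) ∧
    (∀ η : Forms 0, Q 0 η = 0 ↔
      ∃ g : smoothTorus ℂ, ∀ (x : Torus2) (y : Plane), formFun η x y = g.1 (x + torusMk y)) ∧
    (∃ σ : Cohomology 0 ≃ₗ[ℂ] smoothTorus ℂ,
      ∀ (η : cocycles 0) (x : Torus2), (σ (cohomologyClass η)).1 x = formFun η.1 x 0) := by
  have hbot : (coboundaries 0).submoduleOf (cocycles 0) = ⊥ :=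
    (Submodule.comap_bot _).trans (Submodule.ker_subtype _)
  exact ⟨Q_Q, subsingleton_cohomology, Q_zero_eq_zero_iff_exists,
    (Submodule.quotEquivOfEqBot _ hbot).trans
      (LinearEquiv.ofBijective restrictCocycle restrictCocycle_bijective), fun η x => rfl⟩
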